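/- **Theorem 1.1.** Let $X=\ell_p(\mathbb Z)$ with $1\le p<\infty$, or $X=c_0(\mathbb Z)$ (real or complex scalars), and let $w=(w_n)_{n\in\mathbb Z}$ be a sequence of positive real numbers with $0<\inf_n w_n\le\sup_n w_n<\infty$. Let $B_w:X\to X$, $B_w\big((x_n)_{n\in\mathbb Z}\big)=(w_{n+1}x_{n+1})_{n\in\mathbb Z}$, be the associated bilateral weighted shift. A bounded operator $T$ on $X$ is called *strongly structurally stable* if for every $\varepsilon>0$ there is $\delta>0$ such that, for every Lipschitz map $\alpha:X\to X$ with $\sup_x\|\alpha(x)\|\le\delta$ and Lipschitz constant at most $\delta$, there is a map $\varphi:X\to X$ with $\sup_x\|\varphi(x)\|\le\varepsilon$ such that $I+\varphi$ is a homeomorphism of $X$ onto $X$ and $T\circ(I+\varphi)=(I+\varphi)\circ(T+\alpha)$. Then $B_w$ is strongly structurally stable if and only if one of the following conditions holds (each limit being required to exist): - (A) $\displaystyle\lim_{n\to+\infty}\ \sup_{k\in\mathbb Z}\,(w_k\cdots w_{k+n})^{1/n}<1$; - (B) $\displaystyle\lim_{n\to+\infty}\ \inf_{k\in\mathbb Z}\,(w_k\cdots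 w_{k+n})^{1/n}>1$; - (C) $\displaystyle\lim_{n\to+\infty}\ \sup_{k\ge1}\,(w_{-k}w_{-k-1}\cdots w_{-k-n})^{1/n}<1$ and $\displaystyle\lim_{n\to+\infty}\ \inf_{k\ge1}\,(w_kw_{k+1}\cdots w_{k+n})^{1/n}>1$. -/

import Mathlib

open scoped ENNReal ZeroAtInfty
open Filter Topology

namespace BilateralShift

/-- A map `T : E → E` is strongly structurally stable if for every `ε > 0` there is `δ > 0` such
that, for every Lipschitz map `α : E → E` with `‖α‖_∞ ≤ δ` and `Lip(α) ≤ δ`, there is a map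
`φ : E → E` with `‖φ‖_∞ ≤ ε`, with `I + φ` a homeomorphism of `E` onto `E`, and with
`T ∘ (I + φ) = (I + φ) ∘ (T + α)`. -/
def StronglyStructurallyStable {E : Type*} [NormedAddCommGroup E] (T : E → E) : Prop :=
  ∀ ε : ℝ, 0 < ε → ∃ δ : ℝ, 0 < δ ∧
    ∀ α : E → E, (∀ x, ‖α x‖ ≤ δ) → (∀ x y, ‖α x - α y‖ ≤ δ * ‖x - y‖) →
      ∃ φ : E → E, (∀ x, ‖φ x‖ ≤ ε) ∧ IsHomeomorph (fun x => x + φ x) ∧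
        ∀ x, T (x + φ x) = (T x + α x) + φ (T x + α x)

/-- A sequence of positive real numbers indexed by `ℤ`, bounded, and bounded below by a positive
constant. -/
def IsAdmissibleWeight (w : ℤ → ℝ) : Prop :=
  (∃ a : ℝ, 0 < a ∧ ∀ n, a ≤ w n) ∧ (∃ b : ℝ, ∀ n, w n ≤ b)

theorem IsAdmissibleWeight.exists_norm_le {w : ℤ → ℝ} (hw : IsAdmissibleWeight w)
    (𝕜 : Type*) [RCLike 𝕜] : ∃ b : ℝ, 0 ≤ b ∧ ∀ n, ‖((w n : ℝ) : 𝕜)‖ ≤ b := by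
  obtain ⟨⟨a, ha, hal⟩, b, hb⟩ := hw
  refine ⟨b, (ha.le.trans (hal 0)).trans (hb 0), fun n => ?_⟩
  rw [RCLike.norm_ofReal, abs_of_pos (ha.trans_le (hal n))]
  exact hb n

/-- The formal bilateral weighted shift `(x_n)_n ↦ (w_{n+1} x_{n+1})_n` on sequences. -/
def shiftFun {𝕜 : Type*} [RCLike 𝕜] (w : ℤ → ℝ) (x : ℤ → 𝕜) : ℤ → 𝕜 :=
  fun n => ((w (n + 1) : ℝ) : 𝕜) * x (n + 1)

theorem memℓp_shiftFun {𝕜 : Type*} [RCLike 𝕜] {p : ℝ≥0∞} [Fact (1 ≤ p)] (hp : p ≠ ∞)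
    {w : ℤ → ℝ} (hw : IsAdmissibleWeight w) (x : lp (fun _ : ℤ => 𝕜) p) :
    Memℓp (shiftFun w x) p := by
  obtain ⟨b, hb0, hb⟩ := hw.exists_norm_le 𝕜
  have hp0 : 0 < p.toReal :=
    ENNReal.toReal_pos (zero_lt_one.trans_le Fact.out).ne' hp
  refine memℓp_gen ?_
  have h1 : Summable fun n : ℤ => ‖x (n + 1)‖ ^ p.toReal :=
    (Equiv.addRight (1 : ℤ)).summable_iff.2 ((lp.memℓp x).summable hp0)
  refine (h1.mul_left (b ^ p.toReal)).of_nonneg_of_le (fun n => by positivity) (fun n => ?_)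
  rw [← Real.mul_rpow hb0 (norm_nonneg _), shiftFun, norm_mul]
  gcongr
  exact hb _

theorem norm_shiftFun_le {𝕜 : Type*} [RCLike 𝕜] {p : ℝ≥0∞} [Fact (1 ≤ p)] (hp : p ≠ ∞)
    {w : ℤ → ℝ} (hw : IsAdmissibleWeight w) :
    ∃ b : ℝ, ∀ x : lp (fun _ : ℤ => 𝕜) p,
      ‖(⟨shiftFun w x, memℓp_shiftFun hp hw x⟩ : lp (fun _ : ℤ => 𝕜) p)‖ ≤ b * ‖x‖ := by
  obtain ⟨b, hb0, hb⟩ := hw.exists_norm_le 𝕜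
  have hp0 : 0 < p.toReal :=
    ENNReal.toReal_pos (zero_lt_one.trans_le Fact.out).ne' hp
  refine ⟨b, fun x => lp.norm_le_of_tsum_le hp0 (by positivity) ?_⟩
  have h0 : Summable fun n : ℤ => ‖x n‖ ^ p.toReal := (lp.memℓp x).summable hp0
  have h1 : Summable fun n : ℤ => ‖x (n + 1)‖ ^ p.toReal :=
    (Equiv.addRight (1 : ℤ)).summable_iff.2 h0
  have h2 : ∑' n : ℤ, ‖x (n + 1)‖ ^ p.toReal = ∑' n : ℤ, ‖x n‖ ^ p.toReal :=
    (Equiv.addRight (1 : ℤ)).tsum_eq (fun n : ℤ => ‖x n‖ ^ p.toReal)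
  have hle : ∀ n : ℤ, ‖shiftFun w x n‖ ^ p.toReal ≤ b ^ p.toReal * ‖x (n + 1)‖ ^ p.toReal := by
    intro n
    rw [← Real.mul_rpow hb0 (norm_nonneg _), shiftFun, norm_mul]
    gcongr
    exact hb _
  calc ∑' n : ℤ, ‖shiftFun w x n‖ ^ p.toReal
      ≤ ∑' n : ℤ, b ^ p.toReal * ‖x (n + 1)‖ ^ p.toReal :=
        ((memℓp_shiftFun hp hw x).summable hp0).tsum_le_tsum hle (h1.mul_left _)
    _ = (b * ‖x‖) ^ p.toReal := by
        rw [tsum_mul_left, h2, Real.mul_rpow hb0 (norm_nonneg _), lp.norm_rpow_eq_tsum hp0]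

/-- The bilateral weighted shift `B_w` as a bounded operator on `ℓ_p(ℤ)`, `1 ≤ p < ∞`. -/
noncomputable def shiftLp (𝕜 : Type*) [RCLike 𝕜] (p : ℝ≥0∞) [Fact (1 ≤ p)] (hp : p ≠ ∞)
    (w : ℤ → ℝ) (hw : IsAdmissibleWeight w) :
    lp (fun _ : ℤ => 𝕜) p →L[𝕜] lp (fun _ : ℤ => 𝕜) p :=
  LinearMap.mkContinuousOfExistsBound
    { toFun := fun x => ⟨shiftFun w x, memℓp_shiftFun hp hw x⟩
      map_add' := fun _ _ => Subtype.ext (funext fun _ => mul_add _ _ _)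
      map_smul' := fun _ _ => Subtype.ext (funext fun _ => mul_left_comm _ _ _) }
    (norm_shiftFun_le hp hw)

theorem tendsto_shiftFun {𝕜 : Type*} [RCLike 𝕜] {w : ℤ → ℝ} (hw : IsAdmissibleWeight w)
    (x : C₀(ℤ, 𝕜)) : Tendsto (shiftFun w x) (cocompact ℤ) (𝓝 0) := by
  obtain ⟨b, hb0, hb⟩ := hw.exists_norm_le 𝕜
  have h1 : Tendsto (fun n : ℤ => x (n + 1)) (cocompact ℤ) (𝓝 0) :=
    x.zero_at_infty'.comp (Homeomorph.addRight (1 : ℤ)).isClosedEmbedding.tendsto_cocompact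
  refine squeeze_zero_norm (a := fun n : ℤ => b * ‖x (n + 1)‖) (fun n => ?_) ?_
  · rw [shiftFun, norm_mul]
    gcongr
    exact hb _
  · simpa using h1.norm.const_mul b

theorem norm_shiftC0_le {𝕜 : Type*} [RCLike 𝕜] {w : ℤ → ℝ} (hw : IsAdmissibleWeight w) :
    ∃ b : ℝ, ∀ x : C₀(ℤ, 𝕜),
      ‖(⟨⟨shiftFun w x, continuous_of_discreteTopology⟩, tendsto_shiftFun hw x⟩ : C₀(ℤ, 𝕜))‖
        ≤ b * ‖x‖ := by
  obtain ⟨b, hb0, hb⟩ := hw.exists_norm_le 𝕜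
  refine ⟨b, fun x => ?_⟩
  rw [← ZeroAtInftyContinuousMap.norm_toBCF_eq_norm]
  refine (BoundedContinuousFunction.norm_le (by positivity)).2 fun n => ?_
  change ‖((w (n + 1) : ℝ) : 𝕜) * x (n + 1)‖ ≤ _
  rw [norm_mul]
  refine mul_le_mul (hb _) ?_ (norm_nonneg _) hb0
  rw [← ZeroAtInftyContinuousMap.norm_toBCF_eq_norm]
  exact x.toBCF.norm_coe_le_norm (n + 1)

/-- The bilateral weighted shift `B_w` as a bounded operator on `c_0(ℤ)`, the space of sequences
indexed by the discrete space `ℤ` that tend to zero at infinity, with the sup norm. -/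
noncomputable def shiftC0 (𝕜 : Type*) [RCLike 𝕜] (w : ℤ → ℝ) (hw : IsAdmissibleWeight w) :
    C₀(ℤ, 𝕜) →L[𝕜] C₀(ℤ, 𝕜) :=
  LinearMap.mkContinuousOfExistsBound
    { toFun := fun x =>
        ⟨⟨shiftFun w x, continuous_of_discreteTopology⟩, tendsto_shiftFun hw x⟩
      map_add' := fun x y => by ext n; simp [shiftFun, mul_add]
      map_smul' := fun c x => by ext n; simp [shiftFun, mul_left_comm] }
    (norm_shiftC0_le hw)

theorem shiftLp_apply (𝕜 : Type*) [RCLike 𝕜] (p : ℝ≥0∞) [Fact (1 ≤ p)] (hp : p ≠ ∞)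
    (w : ℤ → ℝ) (hw : IsAdmissibleWeight w) (x : lp (fun _ : ℤ => 𝕜) p) (n : ℤ) :
    shiftLp 𝕜 p hp w hw x n = ((w (n + 1) : ℝ) : 𝕜) * x (n + 1) := rfl

theorem shiftC0_apply (𝕜 : Type*) [RCLike 𝕜] (w : ℤ → ℝ) (hw : IsAdmissibleWeight w)
    (x : C₀(ℤ, 𝕜)) (n : ℤ) :
    shiftC0 𝕜 w hw x n = ((w (n + 1) : ℝ) : 𝕜) * x (n + 1) := rfl

/-- `(w_k w_{k+1} ⋯ w_{k+n})^{1/n}`. -/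
noncomputable def forwardMean (w : ℤ → ℝ) (k : ℤ) (n : ℕ) : ℝ :=
  (∏ i ∈ Finset.range (n + 1), w (k + (i : ℤ))) ^ (1 / (n : ℝ))

/-- `(w_k w_{k-1} ⋯ w_{k-n})^{1/n}`. -/
noncomputable def backwardMean (w : ℤ → ℝ) (k : ℤ) (n : ℕ) : ℝ :=
  (∏ i ∈ Finset.range (n + 1), w (k - (i : ℤ))) ^ (1 / (n : ℝ))

/-- `lim_n sup_{k ∈ ℤ} (w_k ⋯ w_{k+n})^{1/n} < 1`. -/
def ConditionA (w : ℤ → ℝ) : Prop :=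
  ∃ L : ℝ, Tendsto (fun n : ℕ => ⨆ k : ℤ, forwardMean w k n) atTop (𝓝 L) ∧ L < 1

/-- `lim_n inf_{k ∈ ℤ} (w_k ⋯ w_{k+n})^{1/n} > 1`. -/
def ConditionB (w : ℤ → ℝ) : Prop :=
  ∃ L : ℝ, Tendsto (fun n : ℕ => ⨅ k : ℤ, forwardMean w k n) atTop (𝓝 L) ∧ 1 < L

/-- `lim_n sup_{k ≥ 1} (w_{-k} ⋯ w_{-k-n})^{1/n} < 1` and
`lim_n inf_{k ≥ 1} (w_k ⋯ w_{k+n})^{1/n} > 1`. -/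
def ConditionC (w : ℤ → ℝ) : Prop :=
  (∃ L : ℝ, Tendsto (fun n : ℕ => ⨆ k : ℕ+, backwardMean w (-((k : ℕ) : ℤ)) n) atTop (𝓝 L) ∧
    L < 1) ∧
  (∃ L : ℝ, Tendsto (fun n : ℕ => ⨅ k : ℕ+, forwardMean w ((k : ℕ) : ℤ) n) atTop (𝓝 L) ∧
    1 < L)

end BilateralShift

/-! Each of the three conditions says that the coordinates split into a set on which the iterates of
`B_w` contract exponentially and a complement on which those of its inverse do. The suprema of
products of consecutive weights are submultiplicative, so Fekete's lemma turns the limits into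
uniform bounds `C * r ^ n` (`conditionA_iff`, `conditionB_iff`, `conditionC_iff`).

Given such bounds, let `P` and `Q` be the two coordinate projections. The operators `T ^ k P` and `T
^ (-k) Q` assemble into a summable kernel `G`, and convolution with `G` solves `v (n + 1) = T (v n)
+ β n` boundedly. With `S = T + α`, the conjugacy is `I + φ` with `φ y = -∑ m, G m (α (S⁻ᵐ y))`. Its
inverse is `I + ψ`, where `ψ` is the fixed point of a contraction; uniqueness of bounded solutions
of the convolution equation shows that one composite is the identity.

Conversely, a perturbation `α` can be made to take prescribed small values along a finite, widely
spaced trajectory. Strong structural stability then gives solutions of `v (n + 1) = T (v n) + e n`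
with bounds independent of the time interval (`StronglyStructurallyStable.exists_bounded_solution`).
A forcing that travels with the shift, followed by compactness, yields a bounded solution on `ℤ` of
`b (j - 1) = w j * b j + δ`. Nonnegativity of `b` propagates to the left, so `{b ≥ 0}` is
everything, empty, or a left half-line, which gives (A), (B), (C) respectively
(`conditions_of_solution`). -/

namespace BilateralShift

/-! ### Growth rates of multiplicative families -/

/-- A family of positive sequences, uniformly of at most exponential growth and decay, such that
the tail of a member after `m` steps is again a member. -/
structure IsMultiplicativeFamily {ι : Type*} (Q : ι → ℕ → ℝ) (a b : ℝ) : Prop where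
  pos : 0 < a
  one_le : 1 ≤ b
  lower : ∀ k n, a ^ n ≤ Q k n
  upper : ∀ k n, Q k n ≤ b ^ n
  mul : ∀ k m n, ∃ k', Q k (m + n) = Q k m * Q k' n

namespace IsMultiplicativeFamily

variable {ι : Type*} {Q : ι → ℕ → ℝ} {a b : ℝ}

theorem apply_pos (h : IsMultiplicativeFamily Q a b) (k : ι) (n : ℕ) : 0 < Q k n :=
  (pow_pos h.pos n).trans_le (h.lower k n)

theorem bddAbove (h : IsMultiplicativeFamily Q a b) (n : ℕ) :
    BddAbove (Set.range fun k => Q k n) :=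
  ⟨b ^ n, by rintro _ ⟨k, rfl⟩; exact h.upper k n⟩

theorem bddAbove_root (h : IsMultiplicativeFamily Q a b) (m n : ℕ) :
    BddAbove (Set.range fun k => Q k m ^ (1 / (n : ℝ))) := by
  refine ⟨(b ^ m) ^ (1 / (n : ℝ)), ?_⟩
  rintro _ ⟨k, rfl⟩
  exact Real.rpow_le_rpow (h.apply_pos k m).le (h.upper k m) (by positivity)

/-- Once the suprema lie below some `r < 1`, the members obey `Q k (n + 1) ≤ r ^ n`. The finitely
many remaining lengths are absorbed into the constant through the a priori bound `b ^ n`. -/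
theorem exponential_bound_of_tendsto (h : IsMultiplicativeFamily Q a b) {L : ℝ}
    (hL : Tendsto (fun n : ℕ => ⨆ k, Q k (n + 1) ^ (1 / (n : ℝ))) atTop (𝓝 L)) (hL1 : L < 1) :
    ∃ C r : ℝ, 0 < r ∧ r < 1 ∧ ∀ k n, Q k n ≤ C * r ^ n := by
  obtain ⟨r, hr, hr1⟩ := exists_between (max_lt hL1 one_pos)
  have hr0 : 0 < r := (le_max_right _ _).trans_lt hr
  obtain ⟨n₀, hn₀⟩ := eventually_atTop.1 (hL.eventually_lt_const ((le_max_left _ _).trans_lt hr))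
  have hb := h.one_le
  have hbr : 1 ≤ b / r := by rw [one_le_div hr0]; linarith
  refine ⟨max (r⁻¹) ((b / r) ^ (n₀ + 1)), r, hr0, hr1, fun k n => ?_⟩
  rcases le_or_gt n (n₀ + 1) with hn | hn
  · calc Q k n ≤ b ^ n := h.upper k n
      _ = (b / r) ^ n * r ^ n := by rw [← mul_pow, div_mul_cancel₀ _ hr0.ne']
      _ ≤ (b / r) ^ (n₀ + 1) * r ^ n := by gcongr
      _ ≤ _ := by gcongr; exact le_max_right _ _
  · obtain ⟨m, rfl⟩ : ∃ m, n = m + 1 := ⟨n - 1, by omega⟩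
    have hm : m ≠ 0 := by omega
    have h1 : Q k (m + 1) ^ (1 / (m : ℝ)) ≤ r :=
      (le_ciSup (h.bddAbove_root (m + 1) m) k).trans (hn₀ m (by omega)).le
    have h2 : Q k (m + 1) ≤ r ^ m := by
      have := pow_le_pow_left₀ (Real.rpow_nonneg (h.apply_pos k _).le _) h1 m
      rwa [one_div, Real.rpow_inv_natCast_pow (h.apply_pos k _).le hm] at this
    calc Q k (m + 1) ≤ r ^ m := h2
      _ = r⁻¹ * r ^ (m + 1) := by rw [pow_succ', inv_mul_cancel_left₀ hr0.ne']
      _ ≤ _ := by gcongr; exact le_max_left _ _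

/-- Since tails of members are again members, `M n = ⨆ k, Q k n` is submultiplicative, and Fekete's
lemma gives the limit of `log (M n) / n`. Positivity of `L` is what allows passing to reciprocals
for infima. -/
theorem tendsto_of_exponential_bound [Nonempty ι] (h : IsMultiplicativeFamily Q a b) {C r : ℝ}
    (hr0 : 0 < r) (hr1 : r < 1) (hC : ∀ k n, Q k n ≤ C * r ^ n) :
    ∃ L : ℝ, 0 < L ∧ L < 1 ∧
      Tendsto (fun n : ℕ => ⨆ k, Q k (n + 1) ^ (1 / (n : ℝ))) atTop (𝓝 L) := by
  set M : ℕ → ℝ := fun n => ⨆ k, Q k n with hM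
  have hle : ∀ k n, Q k n ≤ M n := fun k n => le_ciSup (h.bddAbove n) k
  have hMlow : ∀ n, a ^ n ≤ M n := fun n => (h.lower (Classical.arbitrary ι) n).trans (hle _ n)
  have hMpos : ∀ n, 0 < M n := fun n => (pow_pos h.pos n).trans_le (hMlow n)
  have hMmul : ∀ m n, M (m + n) ≤ M m * M n := fun m n => ciSup_le fun k => by
    obtain ⟨k', hk'⟩ := h.mul k m n
    rw [hk']
    exact mul_le_mul (hle k m) (hle k' n) (h.apply_pos k' n).le (hMpos m).le
  have hsub : Subadditive fun n => Real.log (M n) := fun m n => by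
    rw [← Real.log_mul (hMpos m).ne' (hMpos n).ne']
    exact Real.log_le_log (hMpos _) (hMmul m n)
  have hbdd : BddBelow (Set.range fun n : ℕ => Real.log (M n) / n) := by
    refine ⟨min 0 (Real.log a), ?_⟩
    rintro _ ⟨n, rfl⟩
    rcases Nat.eq_zero_or_pos n with rfl | hn
    · simp
    · refine (min_le_right _ _).trans ?_
      have hn' : (0 : ℝ) < n := by exact_mod_cast hn
      rw [le_div_iff₀ hn', mul_comm, ← Real.log_pow]
      exact Real.log_le_log (pow_pos h.pos n) (hMlow n)
  have hlim := hsub.tendsto_lim hbdd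
  set l := hsub.lim
  have hC0 : 0 < C := by
    have := (h.apply_pos (Classical.arbitrary ι) 0).trans_le (hC _ 0)
    simpa using this
  have hl : l ≤ Real.log r := by
    have h1 : Tendsto (fun n : ℕ => Real.log C / n + Real.log r) atTop (𝓝 (0 + Real.log r)) :=
      (tendsto_const_div_atTop_nhds_zero_nat _).add_const _
    rw [zero_add] at h1
    refine le_of_tendsto_of_tendsto hlim h1 ?_
    filter_upwards [eventually_gt_atTop 0] with n hn
    have hn' : (0 : ℝ) < n := by exact_mod_cast hn
    rw [div_le_iff₀ hn', add_mul, div_mul_cancel₀ _ hn'.ne', mul_comm, ← Real.log_pow,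
      ← Real.log_mul hC0.ne' (pow_pos hr0 n).ne']
    exact Real.log_le_log (hMpos n) (ciSup_le fun k => hC k n)
  refine ⟨Real.exp l, Real.exp_pos l, ?_, ?_⟩
  · rw [Real.exp_lt_one_iff]
    exact hl.trans_lt (Real.log_neg hr0 hr1)
  -- The means take an `n`-th root of `n + 1` factors; the correction `(n + 1) / n` tends to `1`.
  have h2 : Tendsto (fun n : ℕ => Real.log (M (n + 1)) / ((n + 1 : ℕ) : ℝ) * (1 + 1 / (n : ℝ)))
      atTop (𝓝 (l * (1 + 0))) :=
    (hlim.comp (tendsto_add_atTop_nat 1)).mul (tendsto_one_div_atTop_nhds_zero_nat.const_add 1)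
  rw [add_zero, mul_one] at h2
  refine ((Real.continuous_exp.tendsto l).comp h2).congr' ?_
  filter_upwards [eventually_gt_atTop 0] with n hn
  have hn' : (0 : ℝ) < n := by exact_mod_cast hn
  have h3 : (⨆ k, Q k (n + 1) ^ (1 / (n : ℝ))) = M (n + 1) ^ (1 / (n : ℝ)) := by
    refine le_antisymm (ciSup_le fun k => Real.rpow_le_rpow (h.apply_pos k _).le (hle k _)
      (by positivity)) ?_
    have h4 : M (n + 1) ≤ (⨆ k, Q k (n + 1) ^ (1 / (n : ℝ))) ^ n := ciSup_le fun k => by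
      have := pow_le_pow_left₀ (Real.rpow_nonneg (h.apply_pos k _).le _)
        (le_ciSup (h.bddAbove_root (n + 1) n) k) n
      have h6 : (Q k (n + 1) ^ (1 / (n : ℝ))) ^ n = Q k (n + 1) := by
        rw [one_div, Real.rpow_inv_natCast_pow (h.apply_pos k _).le hn.ne']
      exact h6.symm.le.trans this
    have h5 : 0 ≤ ⨆ k, Q k (n + 1) ^ (1 / (n : ℝ)) :=
      Real.iSup_nonneg fun k => Real.rpow_nonneg (h.apply_pos k _).le _
    calc M (n + 1) ^ (1 / (n : ℝ)) ≤ ((⨆ k, Q k (n + 1) ^ (1 / (n : ℝ))) ^ n) ^ (1 / (n : ℝ)) :=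
          Real.rpow_le_rpow (hMpos _).le h4 (by positivity)
      _ = _ := by
          rw [one_div (n : ℝ)] at h5 ⊢
          exact Real.pow_rpow_inv_natCast h5 hn.ne'
  rw [h3, Real.rpow_def_of_pos (hMpos _), Function.comp_apply]
  congr 1
  push_cast
  field_simp

theorem tendsto_iSup_root_iff [Nonempty ι] (h : IsMultiplicativeFamily Q a b) :
    (∃ L : ℝ, Tendsto (fun n : ℕ => ⨆ k, Q k (n + 1) ^ (1 / (n : ℝ))) atTop (𝓝 L) ∧ L < 1) ↔
      ∃ C r : ℝ, 0 < r ∧ r < 1 ∧ ∀ k n, Q k n ≤ C * r ^ n := by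
  constructor
  · rintro ⟨L, hL, hL1⟩
    exact h.exponential_bound_of_tendsto hL hL1
  · rintro ⟨C, r, hr0, hr1, hC⟩
    obtain ⟨L, -, hL1, hL⟩ := h.tendsto_of_exponential_bound hr0 hr1 hC
    exact ⟨L, hL, hL1⟩

theorem inv (h : IsMultiplicativeFamily Q a b) (ha : a ≤ 1) :
    IsMultiplicativeFamily (fun k n => (Q k n)⁻¹) b⁻¹ a⁻¹ where
  pos := inv_pos.2 (one_pos.trans_le h.one_le)
  one_le := (one_le_inv₀ h.pos).2 ha
  lower k n := by
    rw [inv_pow]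
    exact inv_anti₀ (h.apply_pos k n) (h.upper k n)
  upper k n := by
    rw [inv_pow]
    exact inv_anti₀ (pow_pos h.pos n) (h.lower k n)
  mul k m n := by
    obtain ⟨k', hk'⟩ := h.mul k m n
    exact ⟨k', by rw [hk', mul_inv]⟩

/-- Inversion exchanges infima and suprema, so statements about infima reduce to the reciprocal
family. -/
theorem iInf_root_eq [Nonempty ι] (h : IsMultiplicativeFamily Q a b) (ha : a ≤ 1) (m n : ℕ) :
    ⨅ k, Q k m ^ (1 / (n : ℝ)) = (⨆ k, (Q k m)⁻¹ ^ (1 / (n : ℝ)))⁻¹ := by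
  have hpos : ∀ k, 0 < Q k m ^ (1 / (n : ℝ)) := fun k => Real.rpow_pos_of_pos (h.apply_pos k m) _
  have hb := (h.inv ha).bddAbove_root m n
  have hbelow : BddBelow (Set.range fun k => Q k m ^ (1 / (n : ℝ))) :=
    ⟨0, by rintro _ ⟨k, rfl⟩; exact (hpos k).le⟩
  have hinv : ∀ k, (Q k m)⁻¹ ^ (1 / (n : ℝ)) = (Q k m ^ (1 / (n : ℝ)))⁻¹ := fun k =>
    Real.inv_rpow (h.apply_pos k m).le _
  simp only [hinv] at hb ⊢
  have hsup : 0 < ⨆ k, (Q k m ^ (1 / (n : ℝ)))⁻¹ :=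
    (inv_pos.2 (hpos (Classical.arbitrary ι))).trans_le (le_ciSup hb _)
  refine le_antisymm ?_ (le_ciInf fun k => ?_)
  · rcases (Real.iInf_nonneg fun k => (hpos k).le).eq_or_lt with h0 | h0
    · rw [← h0]
      positivity
    · rw [le_inv_comm₀ h0 hsup]
      exact ciSup_le fun k => inv_anti₀ h0 (ciInf_le hbelow k)
  · rw [inv_le_comm₀ hsup (hpos k)]
    exact le_ciSup hb k

theorem tendsto_iInf_root_iff [Nonempty ι] (h : IsMultiplicativeFamily Q a b) (ha : a ≤ 1) :
    (∃ L : ℝ, Tendsto (fun n : ℕ => ⨅ k, Q k (n + 1) ^ (1 / (n : ℝ))) atTop (𝓝 L) ∧ 1 < L) ↔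
      ∃ C r : ℝ, 0 < r ∧ r < 1 ∧ ∀ k n, (Q k n)⁻¹ ≤ C * r ^ n := by
  simp only [h.iInf_root_eq ha]
  constructor
  · rintro ⟨L, hL, hL1⟩
    have := hL.inv₀ (one_pos.trans hL1).ne'
    simp only [inv_inv] at this
    exact (h.inv ha).exponential_bound_of_tendsto this (inv_lt_one_of_one_lt₀ hL1)
  · rintro ⟨C, r, hr0, hr1, hC⟩
    obtain ⟨L, hL0, hL1, hL⟩ := (h.inv ha).tendsto_of_exponential_bound hr0 hr1 hC
    exact ⟨L⁻¹, hL.inv₀ hL0.ne', (one_lt_inv₀ hL0).2 hL1⟩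

end IsMultiplicativeFamily

/-! ### Products of consecutive weights -/

/-- `w_k w_{k+1} ⋯ w_{k+n-1}`. -/
noncomputable def weightProd (w : ℤ → ℝ) (k : ℤ) (n : ℕ) : ℝ :=
  ∏ i ∈ Finset.range n, w (k + (i : ℤ))

section weightProd

variable {w : ℤ → ℝ}

@[simp] theorem weightProd_zero (k : ℤ) : weightProd w k 0 = 1 := by simp [weightProd]

theorem weightProd_succ (k : ℤ) (n : ℕ) :
    weightProd w k (n + 1) = weightProd w k n * w (k + n) := by
  simp [weightProd, Finset.prod_range_succ]

theorem weightProd_add (k : ℤ) (m n : ℕ) :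
    weightProd w k (m + n) = weightProd w k m * weightProd w (k + m) n := by
  simp [weightProd, Finset.prod_range_add, add_assoc]

theorem weightProd_succ' (k : ℤ) (n : ℕ) :
    weightProd w k (n + 1) = w k * weightProd w (k + 1) n := by
  rw [add_comm n 1, weightProd_add]
  simp [weightProd]

theorem prod_backward_eq_weightProd (k : ℤ) (n : ℕ) :
    ∏ i ∈ Finset.range n, w (k - (i : ℤ)) = weightProd w (k + 1 - n) n := by
  rw [weightProd, ← Finset.prod_range_reflect]
  refine Finset.prod_congr rfl fun i hi => ?_
  have := Finset.mem_range.1 hi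
  congr 1
  omega

/-- A positive lower bound at most `1` and an upper bound at least `1` for the weights. -/
theorem IsAdmissibleWeight.exists_bounds (hw : IsAdmissibleWeight w) :
    ∃ a b : ℝ, 0 < a ∧ a ≤ 1 ∧ 1 ≤ b ∧ ∀ n, a ≤ w n ∧ w n ≤ b := by
  obtain ⟨⟨a, ha, hal⟩, b, hb⟩ := hw
  exact ⟨min a 1, max b 1, by positivity, min_le_right _ _, le_max_right _ _, fun n =>
    ⟨(min_le_left _ _).trans (hal n), (hb n).trans (le_max_left _ _)⟩⟩

theorem IsAdmissibleWeight.pos (hw : IsAdmissibleWeight w) (n : ℤ) : 0 < w n := by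
  obtain ⟨⟨a, ha, hal⟩, -⟩ := hw
  exact ha.trans_le (hal n)

theorem IsAdmissibleWeight.weightProd_pos (hw : IsAdmissibleWeight w) (k : ℤ) (n : ℕ) :
    0 < weightProd w k n := Finset.prod_pos fun _ _ => hw.pos _

theorem le_weightProd {a : ℝ} (ha : 0 ≤ a) (h : ∀ n, a ≤ w n) (k : ℤ) (n : ℕ) :
    a ^ n ≤ weightProd w k n := by
  simpa [weightProd] using Finset.prod_le_prod (s := Finset.range n) (fun _ _ => ha)
    (fun i _ => h (k + (i : ℤ)))

theorem weightProd_le {b : ℝ} (hw : IsAdmissibleWeight w) (h : ∀ n, w n ≤ b) (k : ℤ) (n : ℕ) :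
    weightProd w k n ≤ b ^ n := by
  simpa [weightProd] using Finset.prod_le_prod (s := Finset.range n)
    (fun i _ => (hw.pos (k + (i : ℤ))).le) (fun i _ => h (k + (i : ℤ)))

theorem conditionA_iff (hw : IsAdmissibleWeight w) :
    ConditionA w ↔ ∃ C r : ℝ, 0 < r ∧ r < 1 ∧ ∀ k n, weightProd w k n ≤ C * r ^ n := by
  obtain ⟨a, b, ha, ha1, hb, hab⟩ := hw.exists_bounds
  exact IsMultiplicativeFamily.tendsto_iSup_root_iff (Q := fun (k : ℤ) n => weightProd w k n)
    ⟨ha, hb, le_weightProd ha.le fun n => (hab n).1, weightProd_le hw fun n => (hab n).2,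
      fun k m n => ⟨_, weightProd_add k m n⟩⟩

theorem conditionB_iff (hw : IsAdmissibleWeight w) :
    ConditionB w ↔ ∃ C r : ℝ, 0 < r ∧ r < 1 ∧ ∀ k n, (weightProd w k n)⁻¹ ≤ C * r ^ n := by
  obtain ⟨a, b, ha, ha1, hb, hab⟩ := hw.exists_bounds
  exact IsMultiplicativeFamily.tendsto_iInf_root_iff (Q := fun (k : ℤ) n => weightProd w k n)
    ⟨ha, hb, le_weightProd ha.le fun n => (hab n).1, weightProd_le hw fun n => (hab n).2,
      fun k m n => ⟨_, weightProd_add k m n⟩⟩ ha1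

/-- The two halves concern blocks contained in the negative indices and blocks contained in the
positive ones: `k + n ≤ 0` says that the last index `k + n - 1` is at most `-1`. -/
theorem conditionC_iff (hw : IsAdmissibleWeight w) :
    ConditionC w ↔
      (∃ C r : ℝ, 0 < r ∧ r < 1 ∧ ∀ (k : ℤ) (n : ℕ), k + n ≤ 0 → weightProd w k n ≤ C * r ^ n) ∧
      ∃ C r : ℝ, 0 < r ∧ r < 1 ∧ ∀ k n, 0 < k → (weightProd w k n)⁻¹ ≤ C * r ^ n := by
  obtain ⟨a, b, ha, ha1, hb, hab⟩ := hw.exists_bounds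
  refine and_congr ?_ ?_
  · have h := IsMultiplicativeFamily.tendsto_iSup_root_iff (a := a) (b := b)
      (Q := fun (k : ℕ+) n => weightProd w (-((k : ℕ) : ℤ) + 1 - n) n)
      ⟨ha, hb, fun k n => le_weightProd ha.le (fun n => (hab n).1) _ n,
        fun k n => weightProd_le hw (fun n => (hab n).2) _ n, fun k m n =>
        ⟨⟨k + m, by positivity⟩, ?_⟩⟩
    · simp only [backwardMean, prod_backward_eq_weightProd]
      refine h.trans ⟨?_, ?_⟩
      · rintro ⟨C, r, hr0, hr1, hC⟩
        refine ⟨C, r, hr0, hr1, fun k n hk => ?_⟩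
        -- The block starting at `k` ends at `k + n - 1`, which is minus this index.
        have := hC ⟨(1 - k - n).toNat, by omega⟩ n
        rwa [PNat.mk_coe, show -((1 - k - n).toNat : ℤ) + 1 - n = k by omega] at this
      · rintro ⟨C, r, hr0, hr1, hC⟩
        exact ⟨C, r, hr0, hr1, fun k n => hC _ n (by have := k.pos; omega)⟩
    · rw [add_comm m n, weightProd_add, mul_comm]
      congr 2 <;> simp only [PNat.mk_coe, Nat.cast_add] <;> ring
  · have h := IsMultiplicativeFamily.tendsto_iInf_root_iff (a := a) (b := b)
      (Q := fun (k : ℕ+) n => weightProd w ((k : ℕ) : ℤ) n)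
      ⟨ha, hb, fun k n => le_weightProd ha.le (fun n => (hab n).1) _ n,
        fun k n => weightProd_le hw (fun n => (hab n).2) _ n, fun k m n =>
        ⟨⟨k + m, by positivity⟩, by simp [weightProd_add]⟩⟩ ha1
    refine h.trans ⟨?_, ?_⟩
    · rintro ⟨C, r, hr0, hr1, hC⟩
      refine ⟨C, r, hr0, hr1, fun k n hk => ?_⟩
      have := hC ⟨k.toNat, by omega⟩ n
      simpa [show max k 0 = k by omega] using this
    · rintro ⟨C, r, hr0, hr1, hC⟩
      exact ⟨C, r, hr0, hr1, fun k n => hC _ n (by have := k.pos; omega)⟩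

end weightProd

theorem semiconj_zpow {X : Type*} [TopologicalSpace X] {R S : X ≃ₜ X} {f : X → X}
    (hf : ∀ x, f (R x) = S (f x)) (n : ℤ) (x : X) :
    f ((R ^ n) x) = (S ^ n) (f x) := by
  have hinv : ∀ x, f (R⁻¹ x) = S⁻¹ (f x) := fun x => by
    have h1 := hf (R⁻¹ x)
    have h2 : R (R⁻¹ x) = x := R.apply_symm_apply x
    rw [h2] at h1
    rw [h1]
    exact (S.symm_apply_apply _).symm
  induction n using Int.induction_on with
  | zero => simp
  | succ n ih => rw [add_comm, zpow_add, zpow_add, zpow_one, zpow_one, Homeomorph.mul_apply,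
      Homeomorph.mul_apply, hf, ih]
  | pred n ih => rw [sub_eq_add_neg, add_comm, zpow_add, zpow_add, zpow_neg_one, zpow_neg_one,
      Homeomorph.mul_apply, Homeomorph.mul_apply, hinv, ih]

/-! ### Strong structural stability from a summable Green kernel -/

section GreenKernel

variable {𝕜 E : Type*} [RCLike 𝕜] [NormedAddCommGroup E] [NormedSpace 𝕜 E]

/-- A summable kernel `G` such that convolution with `G` solves `v (n + 1) = T (v n) + β n`. -/
structure IsGreenKernel (T : E ≃L[𝕜] E) (G : ℤ → E →L[𝕜] E) : Prop where
  summable : Summable fun m => ‖G m‖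
  succ : ∀ m x, G (m + 1) x = T (G m x) + if m = 0 then x else 0

/-- The convolution `n ↦ ∑ m, G m (β (n - m))`. -/
noncomputable def greenSum (G : ℤ → E →L[𝕜] E) (β : ℤ → E) (n : ℤ) : E := ∑' m, G m (β (n - m))

namespace IsGreenKernel

variable {T : E ≃L[𝕜] E} {G : ℤ → E →L[𝕜] E}

theorem norm_apply_le (G : ℤ → E →L[𝕜] E) {β : ℤ → E} {c : ℝ} (hβ : ∀ n, ‖β n‖ ≤ c) (m n : ℤ) :
    ‖G m (β n)‖ ≤ ‖G m‖ * c :=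
  (G m).le_opNorm_of_le (hβ n)

theorem norm_greenSum_le (h : IsGreenKernel T G) {β : ℤ → E} {c : ℝ} (hβ : ∀ n, ‖β n‖ ≤ c)
    (n : ℤ) : ‖greenSum G β n‖ ≤ (∑' m, ‖G m‖) * c :=
  tsum_of_norm_bounded (h.summable.hasSum.mul_right c) fun m => norm_apply_le G hβ m _

/-- A splitting `1 = P + Q` with `T ^ k P` and `T ^ (-k) Q` exponentially small gives a kernel. -/
theorem exists_of_splitting (T : E ≃L[𝕜] E) {P Q : E →L[𝕜] E} {C r : ℝ} (hr0 : 0 < r) (hr1 : r < 1)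
    (hPQ : ∀ x, P x + Q x = x) (hP : ∀ (k : ℕ) x, ‖(T ^ (k : ℤ)) (P x)‖ ≤ C * r ^ k * ‖x‖)
    (hQ : ∀ (k : ℕ) x, ‖(T ^ (-(k : ℤ))) (Q x)‖ ≤ C * r ^ k * ‖x‖) :
    ∃ G : ℤ → E →L[𝕜] E, IsGreenKernel T G := by
  -- On the zero space the bounds do not force `0 ≤ C`.
  rcases subsingleton_or_nontrivial E with hE | ⟨x₀, y₀, hxy⟩
  · exact ⟨0, ⟨by simp, fun _ _ => Subsingleton.elim _ _⟩⟩
  have hC : 0 ≤ C := by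
    have h0 := (norm_nonneg _).trans (hP 0 (x₀ - y₀))
    rw [pow_zero, mul_one] at h0
    exact nonneg_of_mul_nonneg_left h0 (norm_pos_iff.2 (sub_ne_zero.2 hxy))
  -- Both branches are propagated by `T`; the jump across `m = 0` is `P + Q = 1`, which produces the
  -- source term.
  refine ⟨fun m => if 0 < m then ((T ^ (m - 1) : E ≃L[𝕜] E) : E →L[𝕜] E).comp P
    else -((T ^ (m - 1) : E ≃L[𝕜] E) : E →L[𝕜] E).comp Q, ?_, fun m x => ?_⟩
  · have hs : Summable fun k : ℕ => C * r ^ k :=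
      (summable_geometric_of_lt_one hr0.le hr1).mul_left C
    refine .of_add_one_of_neg_add_one ?_ ?_
    · refine hs.of_nonneg_of_le (fun _ => norm_nonneg _) fun k => ?_
      rw [if_pos (by positivity), add_sub_cancel_right]
      exact ContinuousLinearMap.opNorm_le_bound _ (by positivity) fun x => hP k x
    · refine hs.of_nonneg_of_le (fun _ => norm_nonneg _) fun k => ?_
      rw [if_neg (by omega), norm_neg]
      refine ContinuousLinearMap.opNorm_le_bound _ (by positivity) fun x => ?_
      have h1 := hQ (k + 2) x
      rw [show (-((k + 2 : ℕ) : ℤ)) = -((k : ℤ) + 1) - 1 by push_cast; ring] at h1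
      refine h1.trans ?_
      exact mul_le_mul_of_nonneg_right (mul_le_mul_of_nonneg_left
        (pow_le_pow_of_le_one hr0.le hr1.le (Nat.le_add_right k 2)) hC) (norm_nonneg x)
  · have hT : ∀ (n : ℤ) y, (T ^ n) y = T ((T ^ (n - 1)) y) := fun n y => by
      nth_rewrite 1 [show n = 1 + (n - 1) by ring]
      rw [zpow_add, zpow_one]
      rfl
    rcases lt_trichotomy m 0 with hm | rfl | hm
    · simp [show ¬ 0 < m + 1 by omega, hm.not_gt, hm.ne, hT m]
    · have h1 : T ((T ^ (-1 : ℤ)) (Q x)) = Q x := by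
        exact (hT 0 (Q x)).symm
      simp only [zero_add, zero_lt_one, if_true, sub_self, zpow_zero, lt_irrefl, if_false, zero_sub,
        neg_apply, ContinuousLinearMap.comp_apply,
        ContinuousLinearEquiv.coe_coe, map_neg, h1]
      exact eq_neg_add_of_add_eq ((add_comm _ _).trans (hPQ x))
    · simp [show 0 < m + 1 by omega, hm, hm.ne', hT m]

variable [CompleteSpace E]

theorem summable_apply (h : IsGreenKernel T G) {β : ℤ → E} {c : ℝ} (hβ : ∀ n, ‖β n‖ ≤ c) (n : ℤ) :
    Summable fun m => G m (β (n - m)) :=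
  .of_norm_bounded (h.summable.mul_right c) fun m => norm_apply_le G hβ m _

theorem greenSum_sub (h : IsGreenKernel T G) {β γ : ℤ → E} {c : ℝ} (hβ : ∀ n, ‖β n‖ ≤ c)
    (hγ : ∀ n, ‖γ n‖ ≤ c) (n : ℤ) :
    greenSum G β n - greenSum G γ n = greenSum G (fun n => β n - γ n) n := by
  simp only [greenSum, map_sub]
  exact ((h.summable_apply hβ n).tsum_sub (h.summable_apply hγ n)).symm

/-- Reindexing the sum moves the time step onto `G`, whose jump contributes exactly `β n`. -/
theorem greenSum_succ (h : IsGreenKernel T G) {β : ℤ → E} {c : ℝ} (hβ : ∀ n, ‖β n‖ ≤ c) (n : ℤ) :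
    greenSum G β (n + 1) = T (greenSum G β n) + β n := by
  have h1 : greenSum G β (n + 1) = ∑' m, G (m + 1) (β (n - m)) := by
    rw [greenSum, ← (Equiv.addRight (1 : ℤ)).tsum_eq]
    simp
  have h2 : HasSum (fun m => T (G m (β (n - m)))) (T (greenSum G β n)) :=
    (h.summable_apply hβ n).hasSum.mapL (T : E →L[𝕜] E)
  have h3 : HasSum (fun m : ℤ => if m = 0 then β (n - m) else 0) (β n) := by
    convert hasSum_ite_eq (0 : ℤ) (β n) using 2 with m
    split_ifs with hm <;> simp [hm]
  rw [h1]
  simp only [h.succ]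
  exact (h2.add h3).tsum_eq

/-- Evaluation of the convolution along orbits of a homeomorphism is continuous. -/
theorem continuous_greenSum (h : IsGreenKernel T G) {f : E → E} {c : ℝ} (hf : Continuous f)
    (hc : ∀ x, ‖f x‖ ≤ c) (S : E ≃ₜ E) :
    Continuous fun x => greenSum G (fun n => f ((S ^ n) x)) 0 :=
  continuous_tsum (fun m => (G m).continuous.comp (hf.comp (S ^ (0 - m)).continuous))
    (h.summable.mul_right c) fun m _ => (G m).le_opNorm_of_le (hc _)

/-- Uniqueness of bounded solutions of a contractive convolution equation. -/
theorem eq_of_greenSum_eq (h : IsGreenKernel T G) {α : E → E} {δ : ℝ} (hδ : 0 ≤ δ)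
    (hα : ∀ x, ‖α x‖ ≤ δ) (hlip : ∀ x y, ‖α x - α y‖ ≤ δ * ‖x - y‖)
    (hsmall : (∑' m, ‖G m‖) * δ ≤ 1 / 2) {y u v : ℤ → E}
    (hu : ∀ n, u n = greenSum G (fun n => α (y n + u n)) n)
    (hv : ∀ n, v n = greenSum G (fun n => α (y n + v n)) n) : u = v := by
  have hK : 0 ≤ ∑' m, ‖G m‖ := tsum_nonneg fun _ => norm_nonneg _
  have hstep : ∀ D, (∀ n, ‖u n - v n‖ ≤ D) → ∀ n, ‖u n - v n‖ ≤ 1 / 2 * D := fun D hD n => by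
    have hD0 : 0 ≤ D := (norm_nonneg _).trans (hD 0)
    rw [hu n, hv n, h.greenSum_sub (fun _ => hα _) fun _ => hα _]
    refine (h.norm_greenSum_le (c := δ * D) (fun n => (hlip _ _).trans ?_) n).trans ?_
    · rw [add_sub_add_left_eq_sub]
      exact mul_le_mul_of_nonneg_left (hD n) hδ
    · rw [← mul_assoc]
      exact mul_le_mul_of_nonneg_right hsmall hD0
  have hbase : ∀ n, ‖u n - v n‖ ≤ 1 := fun n => by
    rw [hu n, hv n]
    have h1 := h.norm_greenSum_le (β := fun n => α (y n + u n)) (fun _ => hα _) n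
    have h2 := h.norm_greenSum_le (β := fun n => α (y n + v n)) (fun _ => hα _) n
    exact (norm_sub_le _ _).trans (by linarith)
  have hpow : ∀ k : ℕ, ∀ n, ‖u n - v n‖ ≤ (1 / 2) ^ k := fun k => by
    induction k with
    | zero => simpa using hbase
    | succ k ih =>
      intro n
      rw [pow_succ']
      exact hstep _ ih n
  funext n
  have hlim : Tendsto (fun k : ℕ => (1 / 2 : ℝ) ^ k) atTop (𝓝 0) :=
    tendsto_pow_atTop_nhds_zero_of_lt_one (by norm_num) (by norm_num)
  have := ge_of_tendsto' hlim fun k => hpow k n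
  exact sub_eq_zero.1 (norm_le_zero_iff.1 this)

/-- The bounded continuous solution `ψ` of `ψ x = ∑ m, G m (α (R⁻ᵐ x + ψ (R⁻ᵐ x)))`. -/
theorem exists_fixedPoint (h : IsGreenKernel T G) {α : E → E} {δ : ℝ} (hδ : 0 ≤ δ)
    (hα : ∀ x, ‖α x‖ ≤ δ) (hlip : ∀ x y, ‖α x - α y‖ ≤ δ * ‖x - y‖)
    (hsmall : (∑' m, ‖G m‖) * δ ≤ 1 / 2) (R : E ≃ₜ E) :
    ∃ ψ : E → E, Continuous ψ ∧
      ∀ x, ψ x = greenSum G (fun n => α ((R ^ n) x + ψ ((R ^ n) x))) 0 := by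
  have hαc : Continuous α := by
    have : LipschitzWith δ.toNNReal α := .of_dist_le_mul fun x y => by
      rw [dist_eq_norm, dist_eq_norm, Real.coe_toNNReal _ hδ]
      exact hlip x y
    exact this.continuous
  let F : BoundedContinuousFunction E E → BoundedContinuousFunction E E := fun ψ =>
    .ofNormedAddCommGroup (fun x => greenSum G (fun n => α ((R ^ n) x + ψ ((R ^ n) x))) 0)
      (h.continuous_greenSum (f := fun x => α (x + ψ x))
        (hαc.comp (continuous_id.add ψ.continuous)) (fun _ => hα _) R) _
      (fun x => h.norm_greenSum_le (fun _ => hα _) 0)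
  have hF : ContractingWith (1 / 2) F := by
    refine ⟨by rw [← NNReal.coe_lt_coe]; norm_num, .of_dist_le_mul fun ψ χ => ?_⟩
    refine (BoundedContinuousFunction.dist_le (by positivity)).2 fun x => ?_
    change dist (greenSum G (fun n => α ((R ^ n) x + ψ ((R ^ n) x))) 0)
      (greenSum G (fun n => α ((R ^ n) x + χ ((R ^ n) x))) 0) ≤ _
    rw [dist_eq_norm, h.greenSum_sub (fun _ => hα _) fun _ => hα _]
    refine (h.norm_greenSum_le (c := δ * dist ψ χ) (fun n => (hlip _ _).trans ?_) 0).trans ?_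
    · rw [add_sub_add_left_eq_sub, ← dist_eq_norm]
      exact mul_le_mul_of_nonneg_left (ψ.dist_coe_le_dist _) hδ
    · rw [← mul_assoc]
      exact mul_le_mul_of_nonneg_right (hsmall.trans (by norm_num)) dist_nonneg
  refine ⟨hF.fixedPoint, (hF.fixedPoint).continuous, fun x => ?_⟩
  exact (DFunLike.congr_fun hF.fixedPoint_isFixedPt x).symm

/-- A small Lipschitz perturbation of an invertible operator is a homeomorphism. -/
theorem exists_homeomorph_add (T : E ≃L[𝕜] E) {α : E → E} {δ : ℝ} (hδ : 0 ≤ δ)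
    (hδT : δ * ‖(T.symm : E →L[𝕜] E)‖ < 1) (hlip : ∀ x y, ‖α x - α y‖ ≤ δ * ‖x - y‖) :
    ∃ S : E ≃ₜ E, ∀ x, S x = T x + α x := by
  have happ : ApproximatesLinearOn (fun x => T x + α x) (T : E →L[𝕜] E) Set.univ δ.toNNReal := by
    intro x _ y _
    rw [Real.coe_toNNReal _ hδ]
    convert hlip x y using 2
    simp only [ContinuousLinearEquiv.coe_coe, map_sub]
    abel
  have hc : Subsingleton E ∨ δ.toNNReal < ‖(T.symm : E →L[𝕜] E)‖₊⁻¹ := by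
    rcases subsingleton_or_nontrivial E with hE | hE
    · exact .inl hE
    · right
      have hpos : 0 < ‖(T.symm : E →L[𝕜] E)‖ := T.norm_symm_pos
      rw [← NNReal.coe_lt_coe, Real.coe_toNNReal _ hδ, NNReal.coe_inv, coe_nnnorm,
        ← one_div, lt_div_iff₀ hpos]
      exact hδT
  exact ⟨happ.toHomeomorph _ hc, fun x => rfl⟩

/-- Existence of a summable Green kernel implies strong structural stability. -/
theorem stronglyStructurallyStable (h : IsGreenKernel T G) : StronglyStructurallyStable T := by
  intro ε hε
  set K := ∑' m, ‖G m‖ with hK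
  have hK0 : 0 ≤ K := tsum_nonneg fun _ => norm_nonneg _
  set N := ‖(T.symm : E →L[𝕜] E)‖ with hN
  have hN0 : 0 ≤ N := norm_nonneg _
  have hden : 0 < 2 * (K + N + 1) := by positivity
  -- This `δ` makes `K * δ ≤ 1 / 2` (contraction), `K * δ ≤ ε` (size of `φ`) and `δ * N < 1`
  -- (invertibility of `T + α`).
  refine ⟨min ε 1 / (2 * (K + N + 1)), by positivity, fun α hα hlip => ?_⟩
  set δ := min ε 1 / (2 * (K + N + 1)) with hδdef
  have hδ : 0 ≤ δ := by positivity
  have hδmul : δ * (2 * (K + N + 1)) = min ε 1 := div_mul_cancel₀ _ hden.ne'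
  have hmε := min_le_left ε 1
  have hm1 := min_le_right ε 1
  have hKδ : 0 ≤ K * δ := by positivity
  have hNδ : 0 ≤ δ * N := by positivity
  have hsmall : K * δ ≤ 1 / 2 := by linarith
  have hKε : K * δ ≤ ε := by linarith
  have hNδ1 : δ * N < 1 := by linarith
  have hαc : Continuous α := by
    have : LipschitzWith δ.toNNReal α := .of_dist_le_mul fun x y => by
      rw [dist_eq_norm, dist_eq_norm, Real.coe_toNNReal _ hδ]
      exact hlip x y
    exact this.continuous
  obtain ⟨S, hS⟩ := exists_homeomorph_add T hδ hNδ1 hlip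
  set R : E ≃ₜ E := T.toHomeomorph with hR
  have hRT : ∀ x, R x = T x := fun _ => rfl
  obtain ⟨ψ, hψc, hψ⟩ := h.exists_fixedPoint hδ hα hlip hsmall R
  set φ : E → E := fun y => -greenSum G (fun n => α ((S ^ n) y)) 0 with hφ
  have hφbound : ∀ y, ‖φ y‖ ≤ K * δ := fun y => by
    rw [hφ, norm_neg]
    exact h.norm_greenSum_le (fun _ => hα _) 0
  have hφc : Continuous φ := (h.continuous_greenSum hαc hα S).neg
  -- values along orbits
  have shift : ∀ (f : E → E) (V : E ≃ₜ E) (x : E) (n : ℤ),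
      greenSum G (fun m => f ((V ^ m) ((V ^ n) x))) 0 = greenSum G (fun m => f ((V ^ m) x)) n := by
    intro f V x n
    refine tsum_congr fun m => congrArg (fun z => G m (f z)) ?_
    rw [← Homeomorph.mul_apply, ← zpow_add]
    congr 2
    ring
  have hφn : ∀ y n, φ ((S ^ n) y) = -greenSum G (fun m => α ((S ^ m) y)) n := fun y n => by
    rw [hφ, ← shift α S y n]
  have hψn : ∀ x n, ψ ((R ^ n) x) =
      greenSum G (fun m => α ((R ^ m) x + ψ ((R ^ m) x))) n := fun x n => by
    rw [hψ, shift (fun z => α (z + ψ z)) R x n]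
  have hconjφ : ∀ y, S y + φ (S y) = T (y + φ y) := fun y => by
    have h1 := hφn y 1
    have h2 := h.greenSum_succ (β := fun m => α ((S ^ m) y)) (fun _ => hα _) 0
    rw [zpow_one] at h1
    rw [h1, ← zero_add (1 : ℤ), h2, map_add, hφ, map_neg, hS]
    simp
  have hconjψ : ∀ x, R x + ψ (R x) = S (x + ψ x) := fun x => by
    have h1 := hψn x 1
    have h2 := h.greenSum_succ (β := fun m => α ((R ^ m) x + ψ ((R ^ m) x))) (fun _ => hα _) 0
    rw [zpow_one] at h1
    rw [h1, ← zero_add (1 : ℤ), h2, ← hψ x, hS, map_add, hRT]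
    simp [add_assoc]
  -- Since `I + ψ` carries `R`-orbits to `S`-orbits, the sum defining `φ (x + ψ x)` is minus the
  -- fixed-point sum for `ψ x`.
  have hright : ∀ x, (x + ψ x) + φ (x + ψ x) = x := fun x => by
    have h1 : φ (x + ψ x) = -ψ x := by
      refine (congrArg (fun β => -greenSum G β 0) (funext fun n => congrArg α ?_)).trans
        (congrArg Neg.neg (hψ x).symm)
      rw [← semiconj_zpow (f := fun x => x + ψ x) hconjψ]
    rw [h1]
    abel
  -- Along the `R`-orbit of `y + φ y`, both `ψ` and `-φ` (read on the `S`-orbit of `y`) solve the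
  -- same contractive equation, hence agree.
  have hleft : ∀ y, (y + φ y) + ψ (y + φ y) = y := fun y => by
    have hsc : ∀ n : ℤ, (S ^ n) y + φ ((S ^ n) y) = (R ^ n) (y + φ y) :=
      fun n => semiconj_zpow (R := S) (S := R) (f := fun x => x + φ x) hconjφ n y
    have huniq := h.eq_of_greenSum_eq (y := fun n => (R ^ n) (y + φ y))
      (u := fun n => ψ ((R ^ n) (y + φ y))) (v := fun n => -φ ((S ^ n) y)) hδ hα hlip hsmall
      (fun n => hψn _ n) (fun n => by
        rw [hφn, neg_neg]
        congr 1
        funext m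
        rw [← hsc m, add_neg_cancel_right])
    have h0 := congrFun huniq 0
    simp only [zpow_zero, Homeomorph.one_apply] at h0
    rw [h0, add_neg_cancel_right]
  refine ⟨φ, fun y => (hφbound y).trans hKε, ?_, fun y => ?_⟩
  · rw [isHomeomorph_iff_exists_inverse]
    exact ⟨continuous_id.add hφc, fun x => x + ψ x, hleft, hright, continuous_id.add hψc⟩
  · rw [← hS]
    exact (hconjφ y).symm

end IsGreenKernel

end GreenKernel

/-! ### Bounded solvability from strong structural stability -/

section Shadowing

variable {𝕜 E : Type*} [RCLike 𝕜] [NormedAddCommGroup E] [NormedSpace 𝕜 E]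

/-- Prescribed values at finitely many far apart points are interpolated by a map with small
Lipschitz constant. -/
theorem exists_lipschitz_interpolation (𝕜 : Type*) [RCLike 𝕜] [NormedSpace 𝕜 E] {N : ℕ}
    {y e : ℕ → E} {δ : ℝ} (hδ : 0 ≤ δ) (he : ∀ n, ‖e n‖ ≤ δ)
    (hsep : ∀ i < N, ∀ j < N, i ≠ j → 2 * ((N : ℝ) + 1) ≤ ‖y i - y j‖) :
    ∃ α : E → E, (∀ x, ‖α x‖ ≤ δ) ∧ (∀ x x', ‖α x - α x'‖ ≤ δ * ‖x - x'‖) ∧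
      ∀ i < N, α (y i) = e i := by
  -- Tents of radius `R` around points `2 * R` apart have disjoint supports, and `N` slopes `1 / R`
  -- add up to less than `1`.
  set R : ℝ := N + 1 with hR
  have hR0 : 0 < R := by positivity
  set f : ℕ → E → ℝ := fun i x => max (1 - ‖x - y i‖ / R) 0 with hf
  have hf0 : ∀ i x, 0 ≤ f i x := fun i x => le_max_right _ _
  have hf1 : ∀ i x, f i x ≤ 1 := fun i x =>
    max_le (sub_le_self _ (by positivity)) zero_le_one
  have hfar : ∀ i x, R ≤ ‖x - y i‖ → f i x = 0 := fun i x h =>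
    max_eq_right (by rw [sub_nonpos, one_le_div hR0]; exact h)
  have hflip : ∀ i x x', |f i x - f i x'| ≤ ‖x - x'‖ / R := fun i x x' => by
    refine (abs_max_sub_max_le_abs _ _ _).trans ?_
    rw [sub_sub_sub_cancel_left, ← sub_div, abs_div, abs_of_pos hR0]
    gcongr
    refine (abs_norm_sub_norm_le _ _).trans_eq ?_
    rw [sub_sub_sub_cancel_right, norm_sub_rev]
  have hother : ∀ i < N, ∀ j < N, j ≠ i → ∀ x, ‖x - y i‖ < R → f j x = 0 := by
    intro i hi j hj hij x hx
    refine hfar j x ?_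
    have h1 := hsep j hj i hi hij
    have h2 : ‖y j - y i‖ ≤ ‖x - y i‖ + ‖x - y j‖ := by
      rw [show y j - y i = (x - y i) - (x - y j) by abel]
      exact norm_sub_le _ _
    linarith
  have hsingle : ∀ i < N, ∀ x, ‖x - y i‖ < R →
      ∑ j ∈ Finset.range N, ((f j x : ℝ) : 𝕜) • e j = ((f i x : ℝ) : 𝕜) • e i := by
    intro i hi x hx
    refine Finset.sum_eq_single_of_mem i (Finset.mem_range.2 hi) fun j hj hij => ?_
    rw [hother i hi j (Finset.mem_range.1 hj) hij x hx]
    simp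
  refine ⟨fun x => ∑ i ∈ Finset.range N, ((f i x : ℝ) : 𝕜) • e i, fun x => ?_, fun x x' => ?_,
    fun i hi => ?_⟩
  · by_cases hx : ∃ i < N, ‖x - y i‖ < R
    · obtain ⟨i, hi, hix⟩ := hx
      change ‖∑ j ∈ Finset.range N, ((f j x : ℝ) : 𝕜) • e j‖ ≤ δ
      rw [hsingle i hi x hix, norm_smul, RCLike.norm_ofReal, abs_of_nonneg (hf0 i x)]
      exact (mul_le_of_le_one_left (norm_nonneg _) (hf1 i x)).trans (he i)
    · push Not at hx
      change ‖∑ j ∈ Finset.range N, ((f j x : ℝ) : 𝕜) • e j‖ ≤ δ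
      have h0 : ∑ j ∈ Finset.range N, ((f j x : ℝ) : 𝕜) • e j = 0 :=
        Finset.sum_eq_zero fun i hi => by
          rw [hfar i x (hx i (Finset.mem_range.1 hi)), RCLike.ofReal_zero, zero_smul]
      rwa [h0, norm_zero]
  · rw [← Finset.sum_sub_distrib]
    calc ‖∑ i ∈ Finset.range N, (((f i x : ℝ) : 𝕜) • e i - ((f i x' : ℝ) : 𝕜) • e i)‖
        ≤ ∑ i ∈ Finset.range N, ‖x - x'‖ / R * δ := by
          refine norm_sum_le_of_le _ fun i _ => ?_
          rw [← sub_smul, ← RCLike.ofReal_sub, norm_smul, RCLike.norm_ofReal]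
          exact mul_le_mul (hflip i x x') (he i) (norm_nonneg _) (by positivity)
      _ = N / R * (δ * ‖x - x'‖) := by
          rw [Finset.sum_const, Finset.card_range, nsmul_eq_mul]
          ring
      _ ≤ δ * ‖x - x'‖ := by
          refine mul_le_of_le_one_left (by positivity) ?_
          rw [div_le_one hR0, hR]
          linarith
  · have h0 : ‖y i - y i‖ < R := by simpa using hR0
    change ∑ j ∈ Finset.range N, ((f j (y i) : ℝ) : 𝕜) • e j = e i
    rw [hsingle i hi _ h0, hf]
    simp

/-- A strongly structurally stable operator solves `v (n + 1) = T (v n) + e n` with uniform bounds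
on all finite time intervals, provided it has orbits with pairwise different points. -/
theorem StronglyStructurallyStable.exists_bounded_solution {T : E →L[𝕜] E}
    (hT : StronglyStructurallyStable T) :
    ∃ δ : ℝ, 0 < δ ∧ δ ≤ 1 / 2 ∧ ∀ (N : ℕ) (z : E),
      (∀ i < N, ∀ j < N, i ≠ j → (T ^ i) z ≠ (T ^ j) z) → ∀ e : ℕ → E, (∀ n, ‖e n‖ ≤ δ) →
        ∃ v : ℕ → E, (∀ n, ‖v n‖ ≤ 1) ∧ ∀ n < N, v (n + 1) = T (v n) + e n := by
  obtain ⟨δ₀, hδ₀, h⟩ := hT 1 one_pos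
  refine ⟨min δ₀ (1 / 2), by positivity, min_le_right _ _, fun N z hz e he => ?_⟩
  set δ := min δ₀ (1 / 2) with hδ
  have hδ0 : 0 ≤ δ := by positivity
  have hδle : δ ≤ δ₀ := min_le_left _ _
  let q : ℕ → E := fun n => n.rec 0 fun n x => T x + e n
  have hq : ∀ n, q (n + 1) = T (q n) + e n := fun n => rfl
  -- Adding a large multiple of a free orbit with distinct points keeps the recursion and pushes the
  -- points of the trajectory apart.
  let y : ℕ → ℕ → E := fun k n => (k : 𝕜) • (T ^ n) z + q n
  have hy : ∀ k n, y k (n + 1) = T (y k n) + e n := fun k n => by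
    simp only [y, hq, map_add, map_smul, pow_succ', mul_apply_eq_comp, add_assoc]
  have hsep : ∀ᶠ k in atTop, ∀ i ∈ Finset.range N, ∀ j ∈ Finset.range N, i ≠ j →
      2 * ((N : ℝ) + 1) ≤ ‖y k i - y k j‖ := by
    rw [Filter.eventually_all_finset]
    intro i hi
    rw [Filter.eventually_all_finset]
    intro j hj
    by_cases hij : i = j
    · simp [hij]
    have hpos : 0 < ‖(T ^ i) z - (T ^ j) z‖ :=
      norm_pos_iff.2 (sub_ne_zero.2 (hz i (Finset.mem_range.1 hi) j (Finset.mem_range.1 hj) hij))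
    have hlim : Tendsto (fun k : ℕ => (k : ℝ) * ‖(T ^ i) z - (T ^ j) z‖ - ‖q i - q j‖)
        atTop atTop :=
      tendsto_atTop_add_const_right _ _ (tendsto_natCast_atTop_atTop.atTop_mul_const hpos)
    filter_upwards [hlim.eventually_ge_atTop (2 * ((N : ℝ) + 1))] with k hk _
    have h1 : y k i - y k j = (k : 𝕜) • ((T ^ i) z - (T ^ j) z) - (q j - q i) := by
      simp only [y, smul_sub]
      abel
    rw [h1]
    refine hk.trans (le_trans (le_of_eq ?_) (norm_sub_norm_le _ _))
    rw [norm_smul, RCLike.norm_natCast, norm_sub_rev (q j)]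
  obtain ⟨k, hk⟩ := hsep.exists
  obtain ⟨α, hα, hlip, hαy⟩ := exists_lipschitz_interpolation 𝕜 (y := y k) hδ0 he
    fun i hi j hj => hk i (Finset.mem_range.2 hi) j (Finset.mem_range.2 hj)
  obtain ⟨φ, hφ, -, hconj⟩ := h α (fun x => (hα x).trans hδle) fun x x' =>
    (hlip x x').trans (mul_le_mul_of_nonneg_right hδle (norm_nonneg _))
  -- As `α (y k n) = e n`, the map `T + α` sends `y k n` to `y k (n + 1)`, and the conjugacy
  -- equation there is the recursion for `-φ`.
  refine ⟨fun n => -φ (y k n), fun n => by rw [norm_neg]; exact hφ _, fun n hn => ?_⟩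
  have h2 := hconj (y k n)
  rw [hαy n hn, ← hy, map_add, hy] at h2
  have h3 : T (φ (y k n)) = e n + φ (T (y k n) + e n) := by
    rw [add_assoc] at h2
    exact add_left_cancel h2
  change -φ (y k (n + 1)) = T (-φ (y k n)) + e n
  rw [hy, map_neg, h3]
  abel

end Shadowing

/-! ### The scalar equation `b (j - 1) = w j * b j + δ` -/

section ScalarEquation

/-- Uniformly bounded solutions on all intervals `[-N, N]` yield a bounded solution on `ℤ`. -/
theorem exists_solution_of_finite {w : ℤ → ℝ} {δ : ℝ}
    (h : ∀ N : ℕ, ∃ b : ℤ → ℝ, (∀ j, |b j| ≤ 1) ∧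
      ∀ j, -(N : ℤ) ≤ j → j ≤ N → b (j - 1) = w j * b j + δ) :
    ∃ b : ℤ → ℝ, (∀ j, |b j| ≤ 1) ∧ ∀ j, b (j - 1) = w j * b j + δ := by
  choose b hb1 hb using h
  -- One ultrafilter serves all coordinates, replacing a diagonal subsequence.
  have hlim : ∀ j, ∃ c ∈ Set.Icc (-1 : ℝ) 1,
      Tendsto (fun N => b N j) (hyperfilter ℕ : Filter ℕ) (𝓝 c) := fun j => by
    refine isCompact_Icc.ultrafilter_le_nhds ((hyperfilter ℕ).map fun N => b N j) ?_
    rw [Ultrafilter.coe_map, le_principal_iff]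
    exact mem_map.2 (univ_mem' fun N => abs_le.1 (hb1 N j))
  choose c hc hlim using hlim
  refine ⟨c, fun j => abs_le.2 (hc j), fun j => ?_⟩
  refine tendsto_nhds_unique_of_eventuallyEq (hlim (j - 1))
    (((hlim j).const_mul (w j)).add_const δ) ?_
  have hev : ∀ᶠ N : ℕ in atTop, b N (j - 1) = w j * b N j + δ := by
    filter_upwards [eventually_ge_atTop j.natAbs] with N hN
    exact hb N j (by omega) (by omega)
  exact Nat.hyperfilter_le_atTop hev

variable {w : ℤ → ℝ} {b : ℤ → ℝ} {δ : ℝ}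

/-- Because `b ≤ 1`, one has `w j * b j = b (j - 1) - δ ≤ (1 - δ) * b (j - 1)`, whatever the sign of
`b`; this is iterated. -/
theorem weightProd_mul_le_of_solution (hw : IsAdmissibleWeight w) (hb1 : ∀ j, |b j| ≤ 1)
    (hb : ∀ j, b (j - 1) = w j * b j + δ) (hδ0 : 0 < δ) (hδ1 : δ ≤ 1 / 2) (k : ℤ) (n : ℕ) :
    weightProd w k n * b (k + n - 1) ≤ (1 - δ) ^ n * b (k - 1) := by
  induction n with
  | zero => simp
  | succ n ih =>
    have h1 := hb (k + n)
    have h2 := (abs_le.1 (hb1 (k + n - 1))).2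
    have h3 : w (k + n) * b (k + n) ≤ (1 - δ) * b (k + n - 1) := by nlinarith
    have h4 := mul_le_mul_of_nonneg_left h3 (hw.weightProd_pos k n).le
    have h5 := mul_le_mul_of_nonneg_left ih (show 0 ≤ 1 - δ by linarith)
    rw [weightProd_succ, pow_succ']
    rw [show k + ((n + 1 : ℕ) : ℤ) - 1 = k + n by push_cast; ring]
    linarith

/-- The counterpart for `-b`: here `-b ≤ 1` turns the added `δ` into a factor `1 + δ`. -/
theorem le_weightProd_mul_of_solution (hw : IsAdmissibleWeight w) (hb1 : ∀ j, |b j| ≤ 1)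
    (hb : ∀ j, b (j - 1) = w j * b j + δ) (hδ0 : 0 < δ) (k : ℤ) (n : ℕ) :
    (1 + δ) ^ n * -b (k - 1) ≤ weightProd w k n * -b (k + n - 1) := by
  induction n with
  | zero => simp
  | succ n ih =>
    have h1 := hb (k + n)
    have h2 := (abs_le.1 (hb1 (k + n - 1))).1
    have h3 : (1 + δ) * -b (k + n - 1) ≤ w (k + n) * -b (k + n) := by nlinarith
    have h4 := mul_le_mul_of_nonneg_left h3 (hw.weightProd_pos k n).le
    have h5 := mul_le_mul_of_nonneg_left ih (show 0 ≤ 1 + δ by linarith)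
    rw [weightProd_succ, pow_succ']
    rw [show k + ((n + 1 : ℕ) : ℤ) - 1 = k + n by push_cast; ring]
    linarith

/-- Moving the threshold by one costs one bounded weight, hence only a change of constant. It brings
a sign change of `b` at an arbitrary place back to the origin. -/
theorem exists_le_of_shifted_threshold (hw : IsAdmissibleWeight w) {r : ℝ} (hr : 0 < r) {J : ℤ}
    (h : ∃ C, ∀ (k : ℤ) (n : ℕ), k + n ≤ J → weightProd w k n ≤ C * r ^ n) (J' : ℤ) :
    ∃ C, ∀ (k : ℤ) (n : ℕ), k + n ≤ J' → weightProd w k n ≤ C * r ^ n := by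
  obtain ⟨a, B, -, -, hB, hab⟩ := hw.exists_bounds
  have hstep : ∀ d : ℕ, ∃ C, ∀ (k : ℤ) (n : ℕ), k + n ≤ J + d → weightProd w k n ≤ C * r ^ n := by
    intro d
    induction d with
    | zero => simpa using h
    | succ d ih =>
      obtain ⟨C, hC⟩ := ih
      refine ⟨max 1 (C * B / r), fun k n hk => ?_⟩
      rcases n with _ | n
      · simp
      · have h1 := hC k n (by push_cast at hk ⊢; omega)
        have h2 : 0 ≤ C * r ^ n := (hw.weightProd_pos k n).le.trans h1
        calc weightProd w k (n + 1) = weightProd w k n * w (k + n) := weightProd_succ k n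
          _ ≤ C * r ^ n * B := mul_le_mul h1 (hab _).2 (hw.pos _).le h2
          _ = C * B / r * r ^ (n + 1) := by rw [pow_succ]; field_simp
          _ ≤ _ := by gcongr; exact le_max_right _ _
  obtain ⟨C, hC⟩ := hstep (J' - J).toNat
  exact ⟨C, fun k n hk => hC k n (by omega)⟩

theorem exists_inv_le_of_shifted_threshold (hw : IsAdmissibleWeight w) {r : ℝ} (hr : 0 < r) {J : ℤ}
    (h : ∃ C, ∀ (k : ℤ) (n : ℕ), J < k → (weightProd w k n)⁻¹ ≤ C * r ^ n) (J' : ℤ) :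
    ∃ C, ∀ (k : ℤ) (n : ℕ), J' < k → (weightProd w k n)⁻¹ ≤ C * r ^ n := by
  obtain ⟨a, B, ha, -, hB, hab⟩ := hw.exists_bounds
  have hstep : ∀ d : ℕ, ∃ C, ∀ (k : ℤ) (n : ℕ), J - d < k → (weightProd w k n)⁻¹ ≤ C * r ^ n := by
    intro d
    induction d with
    | zero => simpa using h
    | succ d ih =>
      obtain ⟨C, hC⟩ := ih
      refine ⟨max 1 (C * a⁻¹ / r), fun k n hk => ?_⟩
      rcases n with _ | n
      · simp
      · have h1 := hC (k + 1) n (by push_cast at hk ⊢; omega)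
        have h2 : 0 ≤ C * r ^ n := (inv_pos.2 (hw.weightProd_pos _ n)).le.trans h1
        calc (weightProd w k (n + 1))⁻¹ = (weightProd w (k + 1) n)⁻¹ * (w k)⁻¹ := by
              rw [weightProd_succ', mul_inv, mul_comm]
          _ ≤ C * r ^ n * a⁻¹ :=
              mul_le_mul h1 (inv_anti₀ ha (hab _).1) (inv_pos.2 (hw.pos _)).le h2
          _ = C * a⁻¹ / r * r ^ (n + 1) := by rw [pow_succ]; field_simp
          _ ≤ _ := by gcongr; exact le_max_right _ _
  obtain ⟨C, hC⟩ := hstep (J - J').toNat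
  exact ⟨C, fun k n hk => hC k n (by omega)⟩

/-- The sign pattern of a bounded solution decides between the three conditions. -/
theorem conditions_of_solution (hw : IsAdmissibleWeight w) (hb1 : ∀ j, |b j| ≤ 1)
    (hb : ∀ j, b (j - 1) = w j * b j + δ) (hδ0 : 0 < δ) (hδ1 : δ ≤ 1 / 2) :
    ConditionA w ∨ ConditionB w ∨ ConditionC w := by
  have hpos : ∀ (k : ℤ) (n : ℕ), 0 ≤ b (k + n) → weightProd w k n ≤ δ⁻¹ * (1 - δ) ^ n := by
    intro k n hkn
    have h1 := weightProd_mul_le_of_solution hw hb1 hb hδ0 hδ1 k n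
    have h2 : δ ≤ b (k + n - 1) := by
      rw [hb]
      have := mul_nonneg (hw.pos (k + n)).le hkn
      linarith
    have h3 : (1 - δ) ^ n * b (k - 1) ≤ (1 - δ) ^ n :=
      mul_le_of_le_one_right (pow_nonneg (by linarith) n) (abs_le.1 (hb1 _)).2
    have h4 := mul_le_mul_of_nonneg_left h2 (hw.weightProd_pos k n).le
    rw [← div_eq_inv_mul, le_div_iff₀ hδ0]
    linarith
  obtain ⟨a, B, -, -, hB, hab⟩ := hw.exists_bounds
  have hneg : ∀ (k : ℤ) (n : ℕ), b (k - 2) < 0 →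
      (weightProd w k n)⁻¹ ≤ B / δ * ((1 + δ)⁻¹) ^ n := by
    intro k n hkn
    have h1 := le_weightProd_mul_of_solution hw hb1 hb hδ0 k n
    have h2 : δ ≤ B * -b (k - 1) := by
      have h3 := hb (k - 1)
      rw [show k - 1 - 1 = k - 2 by ring] at h3
      have h4 := (hw.pos (k - 1))
      have h5 := (hab (k - 1)).2
      have h6 : 0 ≤ -b (k - 1) := by
        by_contra h7
        have := mul_nonneg h4.le (show 0 ≤ b (k - 1) by linarith)
        linarith
      have := mul_le_mul_of_nonneg_right h5 h6
      linarith
    have hp : 0 < (1 + δ) ^ n := by positivity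
    have hW := hw.weightProd_pos k n
    have h8 : weightProd w k n * -b (k + n - 1) ≤ weightProd w k n :=
      mul_le_of_le_one_right hW.le (by linarith [(abs_le.1 (hb1 (k + n - 1))).1])
    have h9 : (1 + δ) ^ n * δ ≤ B * weightProd w k n := by
      have h10 := mul_le_mul_of_nonneg_left h2 hp.le
      have h11 := mul_le_mul_of_nonneg_left (h1.trans h8) (show 0 ≤ B by linarith)
      linarith
    rw [inv_pow, ← div_eq_mul_inv, div_div, inv_eq_one_div, div_le_div_iff₀ hW (by positivity)]
    linarith
  -- The equation determines `b (j - 1)` from `b j` with positive coefficients, so nonnegativity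
  -- spreads leftwards.
  have hmono : ∀ j, 0 ≤ b j → ∀ i ≤ j, 0 ≤ b i := by
    intro j hj i hij
    induction i, hij using Int.leInductionDown with
    | base => exact hj
    | pred i hi ih =>
      rw [hb]
      have := mul_nonneg (hw.pos i).le ih
      linarith
  have hr1 : (1 + δ)⁻¹ < 1 := inv_lt_one_of_one_lt₀ (by linarith)
  have hr0 : 0 < (1 + δ)⁻¹ := by positivity
  by_cases hA : ∀ j, 0 ≤ b j
  · exact .inl ((conditionA_iff hw).2
      ⟨_, _, by linarith, by linarith, fun k n => hpos k n (hA _)⟩)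
  by_cases hB : ∀ j, b j < 0
  · exact .inr (.inl ((conditionB_iff hw).2 ⟨_, _, hr0, hr1, fun k n => hneg k n (hB _)⟩))
  push Not at hA hB
  obtain ⟨i, hi⟩ := hA
  obtain ⟨j, hj⟩ := hB
  refine .inr (.inr ((conditionC_iff hw).2 ⟨?_, ?_⟩))
  · obtain ⟨C, hC⟩ := exists_le_of_shifted_threshold hw (show 0 < 1 - δ by linarith) (J := j)
      ⟨_, fun k n hk => hpos k n (hmono j hj _ hk)⟩ 0
    exact ⟨C, 1 - δ, by linarith, by linarith, hC⟩
  -- `hneg` needs `b (k - 2) < 0`, which holds once `k - 2 ≥ i`.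
  · obtain ⟨C, hC⟩ := exists_inv_le_of_shifted_threshold hw hr0 (J := i + 1)
      ⟨_, fun k n hk => hneg k n (not_le.1 fun h => hi.not_ge (hmono _ h i (by omega)))⟩ 0
    exact ⟨C, _, hr0, hr1, fun k n hk => hC k n hk⟩

end ScalarEquation

/-! ### Weighted shifts on abstract sequence spaces -/

section SequenceSpace

variable {𝕜 E : Type*} [RCLike 𝕜] [NormedAddCommGroup E] [NormedSpace 𝕜 E]

/-- The coordinate map of a solid translation invariant sequence space over `ℤ` whose unit vectors
have norm at most one and whose coordinate functionals are contractions. -/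
structure IsSequenceSpace (c : E →ₗ[𝕜] ℤ → 𝕜) : Prop where
  norm_coord_le : ∀ x n, ‖c x n‖ ≤ ‖x‖
  exists_of_le : ∀ {C : ℝ}, 0 ≤ C → ∀ (f : ℤ → 𝕜) x (k : ℤ), (∀ n, ‖f n‖ ≤ C * ‖c x (n + k)‖) →
    ∃ y, c y = f ∧ ‖y‖ ≤ C * ‖x‖
  exists_single : ∀ j, ∃ x, c x = Pi.single j 1 ∧ ‖x‖ ≤ 1
  injective : Function.Injective c

namespace IsSequenceSpace

variable {c : E →ₗ[𝕜] ℤ → 𝕜}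

theorem norm_le (hc : IsSequenceSpace c) {C : ℝ} (hC : 0 ≤ C) {x y : E} (k : ℤ)
    (h : ∀ n, ‖c y n‖ ≤ C * ‖c x (n + k)‖) : ‖y‖ ≤ C * ‖x‖ := by
  obtain ⟨z, hz, hle⟩ := hc.exists_of_le hC _ x k h
  rwa [hc.injective hz] at hle

/-- Translations followed by bounded multipliers act as bounded operators. -/
theorem exists_operator (hc : IsSequenceSpace c) {C : ℝ} (hC : 0 ≤ C) {m : ℤ → 𝕜}
    (hm : ∀ n, ‖m n‖ ≤ C) (k : ℤ) : ∃ L : E →L[𝕜] E, ∀ x n, c (L x) n = m n * c x (n + k) := by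
  have hle : ∀ x n, ‖m n * c x (n + k)‖ ≤ C * ‖c x (n + k)‖ := fun x n => by
    rw [norm_mul]
    exact mul_le_mul_of_nonneg_right (hm n) (norm_nonneg _)
  choose L hL hLle using fun x => hc.exists_of_le hC (fun n => m n * c x (n + k)) x k (hle x)
  refine ⟨LinearMap.mkContinuous
    { toFun := L
      map_add' := fun x y => hc.injective ?_
      map_smul' := fun a x => hc.injective ?_ } C hLle, fun x n => congrFun (hL x) n⟩
  · rw [map_add, hL, hL, hL]
    funext n
    simp [mul_add]
  · simp only [map_smul, hL, RingHom.id_apply]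
    funext n
    simp [mul_left_comm]

variable {w : ℤ → ℝ}

theorem exists_equiv (hc : IsSequenceSpace c) (hw : IsAdmissibleWeight w) {T : E →L[𝕜] E}
    (hT : ∀ x n, c (T x) n = (w (n + 1) : 𝕜) * c x (n + 1)) :
    ∃ T' : E ≃L[𝕜] E, (∀ x, T' x = T x) ∧
      ∀ x n, c (T'.symm x) n = ((w n)⁻¹ : ℝ) * c x (n - 1) := by
  obtain ⟨a, b, ha, -, -, hab⟩ := hw.exists_bounds
  obtain ⟨L, hL⟩ := hc.exists_operator (m := fun n => (((w n)⁻¹ : ℝ) : 𝕜)) (inv_pos.2 ha).le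
    (fun n => by
      rw [RCLike.norm_ofReal, abs_of_pos (inv_pos.2 (hw.pos n))]
      exact inv_anti₀ ha (hab n).1) (-1)
  have hne : ∀ n, (w n : 𝕜) ≠ 0 := fun n => RCLike.ofReal_ne_zero.2 (hw.pos n).ne'
  refine ⟨ContinuousLinearEquiv.equivOfInverse T L (fun x => hc.injective (funext fun n => ?_))
    (fun x => hc.injective (funext fun n => ?_)), fun x => rfl, fun x n => hL x n⟩
  · rw [hL, hT, RCLike.ofReal_inv, neg_add_cancel_right, inv_mul_cancel_left₀ (hne n)]
  · rw [hT, hL, RCLike.ofReal_inv, add_neg_cancel_right, mul_inv_cancel_left₀ (hne _)]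

theorem coord_pow (c : E →ₗ[𝕜] ℤ → 𝕜) {T : E →L[𝕜] E}
    (hT : ∀ x n, c (T x) n = (w (n + 1) : 𝕜) * c x (n + 1)) (k : ℕ) (x : E) (n : ℤ) :
    c ((T ^ k) x) n = (weightProd w (n + 1) k : 𝕜) * c x (n + k) := by
  induction k generalizing n with
  | zero => simp
  | succ k ih =>
    rw [weightProd_succ', pow_succ', mul_apply_eq_comp, hT, ih, RCLike.ofReal_mul, mul_assoc,
      Nat.cast_succ, add_comm (k : ℤ) 1, ← add_assoc n 1 (k : ℤ)]

theorem coord_symm_pow (c : E →ₗ[𝕜] ℤ → 𝕜) {L : E →L[𝕜] E}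
    (hL : ∀ x n, c (L x) n = ((w n)⁻¹ : ℝ) * c x (n - 1)) (k : ℕ) (x : E) (n : ℤ) :
    c ((L ^ k) x) n = ((weightProd w (n + 1 - k) k)⁻¹ : ℝ) * c x (n - k) := by
  induction k generalizing n with
  | zero => simp
  | succ k ih =>
    have h1 : weightProd w (n + 1 - (k + 1 : ℕ)) (k + 1) = weightProd w (n - 1 + 1 - k) k * w n := by
      rw [weightProd_succ, show n + 1 - ((k + 1 : ℕ) : ℤ) = n - 1 + 1 - k by push_cast; ring,
        show n - 1 + 1 - (k : ℤ) + k = n by ring]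
    rw [pow_succ', mul_apply_eq_comp, hL, ih, h1, mul_inv, mul_comm (_⁻¹ : ℝ), RCLike.ofReal_mul,
      mul_assoc, show n - ((k + 1 : ℕ) : ℤ) = n - 1 - k by push_cast; ring]

/-- Contraction from the coordinates in `s` forwards in time and from those outside `s` backwards
in time implies strong structural stability. -/
theorem stronglyStructurallyStable_of_bounds [CompleteSpace E] (hc : IsSequenceSpace c)
    (hw : IsAdmissibleWeight w) {T : E →L[𝕜] E}
    (hT : ∀ x n, c (T x) n = (w (n + 1) : 𝕜) * c x (n + 1)) (s : Set ℤ) {C r : ℝ} (hr0 : 0 < r)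
    (hr1 : r < 1) (hC : 0 ≤ C)
    (hs : ∀ (j : ℤ) (k : ℕ), j ∈ s → weightProd w (j + 1 - k) k ≤ C * r ^ k)
    (hs' : ∀ (j : ℤ) (k : ℕ), j ∉ s → (weightProd w (j + 1) k)⁻¹ ≤ C * r ^ k) :
    StronglyStructurallyStable T := by
  obtain ⟨T', hT', hsymm⟩ := hc.exists_equiv hw hT
  have hind : ∀ (t : Set ℤ) n, ‖t.indicator (fun _ => (1 : 𝕜)) n‖ ≤ 1 := fun t n => by
    by_cases hn : n ∈ t <;> simp [hn]
  obtain ⟨P, hP⟩ := hc.exists_operator zero_le_one (hind s) 0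
  obtain ⟨Q, hQ⟩ := hc.exists_operator zero_le_one (hind sᶜ) 0
  simp only [add_zero] at hP hQ
  have hcoe : T = (T' : E →L[𝕜] E) := ContinuousLinearMap.ext fun x => (hT' x).symm
  have hpow : ∀ (k : ℕ) x, (T' ^ (k : ℤ)) x = (T ^ k) x := fun k x => by
    induction k with
    | zero => rfl
    | succ k ih =>
      rw [pow_succ', mul_apply_eq_comp, ← ih, Nat.cast_succ, add_comm, zpow_add, zpow_one, ← hT']
      rfl
  have hpow' : ∀ (k : ℕ) x, (T' ^ (-(k : ℤ))) x = ((T'.symm : E →L[𝕜] E) ^ k) x := fun k x => by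
    induction k with
    | zero => rfl
    | succ k ih =>
      rw [pow_succ', mul_apply_eq_comp, ← ih, Nat.cast_succ, neg_add_rev, zpow_add, zpow_neg_one]
      rfl
  have hG : ∃ G : ℤ → E →L[𝕜] E, IsGreenKernel T' G := by
    refine IsGreenKernel.exists_of_splitting T' (P := P) (Q := Q) (C := C) hr0 hr1
      (fun x => hc.injective (funext fun n => ?_)) (fun k x => ?_) (fun k x => ?_)
    · rw [map_add, Pi.add_apply, hP, hQ]
      by_cases hn : n ∈ s <;> simp [hn]
    · rw [hpow]
      refine hc.norm_le (by positivity) (k : ℤ) fun n => ?_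
      rw [coord_pow c hT, hP]
      by_cases hn : n + (k : ℤ) ∈ s
      · rw [Set.indicator_of_mem hn, one_mul, norm_mul, RCLike.norm_ofReal,
          abs_of_pos (hw.weightProd_pos _ _)]
        have := hs _ k hn
        rw [show n + (k : ℤ) + 1 - k = n + 1 by ring] at this
        exact mul_le_mul_of_nonneg_right this (norm_nonneg _)
      · rw [Set.indicator_of_notMem hn, zero_mul, mul_zero, norm_zero]
        positivity
    · rw [hpow']
      refine hc.norm_le (by positivity) (-(k : ℤ)) fun n => ?_
      rw [coord_symm_pow (w := w) c hsymm, hQ, ← sub_eq_add_neg]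
      by_cases hn : n - (k : ℤ) ∈ s
      · rw [Set.indicator_of_notMem (by simpa using hn), zero_mul, mul_zero, norm_zero]
        positivity
      · rw [Set.indicator_of_mem (by simpa using hn), one_mul, norm_mul, RCLike.norm_ofReal,
          abs_of_pos (inv_pos.2 (hw.weightProd_pos _ _))]
        have := hs' _ k hn
        rw [show n - (k : ℤ) + 1 = n + 1 - k by ring] at this
        exact mul_le_mul_of_nonneg_right this (norm_nonneg _)
  obtain ⟨G, hG⟩ := hG
  rw [hcoe]
  exact hG.stronglyStructurallyStable

/-- At time `n` the forcing is `δ` times the unit vector at `N - n - 1`, so it moves along with the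
shift. Reading coordinate `j` at time `N - j` reduces the vector recursion to the scalar equation.
-/
theorem conditions_of_stronglyStructurallyStable (hc : IsSequenceSpace c)
    (hw : IsAdmissibleWeight w) {T : E →L[𝕜] E}
    (hT : ∀ x n, c (T x) n = (w (n + 1) : 𝕜) * c x (n + 1)) (h : StronglyStructurallyStable T) :
    ConditionA w ∨ ConditionB w ∨ ConditionC w := by
  obtain ⟨δ, hδ0, hδ1, hsol⟩ := h.exists_bounded_solution
  choose u hu hu1 using hc.exists_single
  obtain ⟨b, hb1, hb⟩ := exists_solution_of_finite (w := w) (δ := δ) fun N => by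
    -- The orbit of a unit vector visits different coordinates; times `0` to `2 * N` correspond to
    -- `j` from `N` down to `-N`.
    have hinj : ∀ i < 2 * N + 1, ∀ j < 2 * N + 1, i ≠ j → (T ^ i) (u N) ≠ (T ^ j) (u N) := by
      intro i _ j _ hij heq
      have h1 := congrFun (congrArg c heq) (N - (i : ℤ))
      rw [coord_pow c hT, coord_pow c hT, hu, sub_add_cancel, Pi.single_eq_same,
        Pi.single_eq_of_ne (by omega), mul_zero, mul_one] at h1
      exact (hw.weightProd_pos _ _).ne' (RCLike.ofReal_eq_zero.1 h1)
    obtain ⟨v, hv1, hv⟩ := hsol (2 * N + 1) (u N) hinj (fun n => (δ : 𝕜) • u ((N : ℤ) - n - 1))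
      fun n => by
        rw [norm_smul, RCLike.norm_ofReal, abs_of_pos hδ0]
        exact mul_le_of_le_one_right hδ0.le (hu1 _)
    refine ⟨fun j => RCLike.re (c (v (N - j).toNat) j), fun j => ?_, fun j hj1 hj2 => ?_⟩
    · exact (RCLike.abs_re_le_norm _).trans ((hc.norm_coord_le _ _).trans (hv1 _))
    · obtain ⟨n, hn⟩ : ∃ n : ℕ, (N : ℤ) - j = n := ⟨(N - j).toNat, by omega⟩
      have h1 := congrFun (congrArg c (hv n (by omega))) (j - 1)
      rw [map_add, map_smul, Pi.add_apply, Pi.smul_apply, hT, hu,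
        show (N : ℤ) - n - 1 = j - 1 by omega, Pi.single_eq_same, sub_add_cancel, smul_eq_mul,
        mul_one] at h1
      change RCLike.re (c (v (N - (j - 1)).toNat) (j - 1)) = _
      rw [show ((N : ℤ) - (j - 1)).toNat = n + 1 by omega, h1, map_add, RCLike.re_ofReal_mul,
        RCLike.ofReal_re]
      change _ = w j * RCLike.re (c (v (N - j).toNat) j) + δ
      rw [show ((N : ℤ) - j).toNat = n by omega]
  exact conditions_of_solution hw hb1 hb hδ0 hδ1

/-- The characterization for weighted shifts on any sequence space. -/
theorem stronglyStructurallyStable_iff [CompleteSpace E] (hc : IsSequenceSpace c)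
    (hw : IsAdmissibleWeight w) {T : E →L[𝕜] E}
    (hT : ∀ x n, c (T x) n = (w (n + 1) : 𝕜) * c x (n + 1)) :
    StronglyStructurallyStable T ↔ ConditionA w ∨ ConditionB w ∨ ConditionC w := by
  refine ⟨hc.conditions_of_stronglyStructurallyStable hw hT, ?_⟩
  rintro (h | h | h)
  · obtain ⟨C, r, hr0, hr1, hC⟩ := (conditionA_iff hw).1 h
    have hC0 : 0 ≤ C := by simpa using (hw.weightProd_pos 0 0).le.trans (hC 0 0)
    exact hc.stronglyStructurallyStable_of_bounds hw hT Set.univ hr0 hr1 hC0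
      (fun j k _ => hC _ k) fun j k hj => absurd (Set.mem_univ j) hj
  · obtain ⟨C, r, hr0, hr1, hC⟩ := (conditionB_iff hw).1 h
    have hC0 : 0 ≤ C := by simpa using (inv_pos.2 (hw.weightProd_pos 0 0)).le.trans (hC 0 0)
    exact hc.stronglyStructurallyStable_of_bounds hw hT ∅ hr0 hr1 hC0
      (fun j k hj => hj.elim) fun j k _ => hC _ k
  · obtain ⟨⟨C, r, hr0, hr1, hC⟩, C', r', hr0', hr1', hC'⟩ := (conditionC_iff hw).1 h
    have hC0 : 0 ≤ C := by simpa using (hw.weightProd_pos 0 0).le.trans (hC 0 0 le_rfl)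
    have hC0' : 0 ≤ C' := by
      simpa using (inv_pos.2 (hw.weightProd_pos 1 0)).le.trans (hC' 1 0 one_pos)
    have hmax : ∀ k : ℕ, C * r ^ k ≤ max C C' * max r r' ^ k := fun k =>
      mul_le_mul (le_max_left _ _) (pow_le_pow_left₀ hr0.le (le_max_left _ _) k)
        (by positivity) (by positivity)
    have hmax' : ∀ k : ℕ, C' * r' ^ k ≤ max C C' * max r r' ^ k := fun k =>
      mul_le_mul (le_max_right _ _) (pow_le_pow_left₀ hr0'.le (le_max_right _ _) k)
        (by positivity) (by positivity)
    -- Blocks ending at `j < 0` contain only negative indices, and blocks starting at `j + 1` with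
    -- `j ≥ 0` only positive ones.
    exact hc.stronglyStructurallyStable_of_bounds hw hT {j | j < 0} (by positivity)
      (max_lt hr1 hr1') (by positivity)
      (fun j k hj => (hC _ k (by have : j < 0 := hj; omega)).trans (hmax k))
      fun j k hj => (hC' _ k (by have : ¬ j < 0 := hj; omega)).trans (hmax' k)

end IsSequenceSpace

/-! ### The concrete sequence spaces `ℓ_p(ℤ)` and `c_0(ℤ)`. -/

theorem isSequenceSpace_lp (𝕜 : Type*) [RCLike 𝕜] {p : ℝ≥0∞} [Fact (1 ≤ p)] (hp : p ≠ ∞) :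
    IsSequenceSpace (𝕜 := 𝕜) (E := lp (fun _ : ℤ => 𝕜) p)
      { toFun := fun x => ⇑x, map_add' := fun _ _ => rfl, map_smul' := fun _ _ => rfl } where
  norm_coord_le x n := lp.norm_apply_le_norm (zero_lt_one.trans_le Fact.out).ne' x n
  exists_of_le {C} hC f x k h := by
    have hp0 : 0 < p.toReal := ENNReal.toReal_pos (zero_lt_one.trans_le Fact.out).ne' hp
    have h0 : Summable fun n : ℤ => ‖x n‖ ^ p.toReal := (lp.memℓp x).summable hp0
    have h1 : Summable fun n : ℤ => ‖x (n + k)‖ ^ p.toReal :=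
      (Equiv.addRight k).summable_iff.2 h0
    have h2 : ∑' n : ℤ, ‖x (n + k)‖ ^ p.toReal = ∑' n : ℤ, ‖x n‖ ^ p.toReal :=
      (Equiv.addRight k).tsum_eq (fun n : ℤ => ‖x n‖ ^ p.toReal)
    have hle : ∀ n, ‖f n‖ ^ p.toReal ≤ C ^ p.toReal * ‖x (n + k)‖ ^ p.toReal := fun n => by
      rw [← Real.mul_rpow hC (norm_nonneg _)]
      exact Real.rpow_le_rpow (norm_nonneg _) (h n) hp0.le
    have hf : Summable fun n => ‖f n‖ ^ p.toReal :=
      (h1.mul_left _).of_nonneg_of_le (fun n => by positivity) hle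
    refine ⟨⟨f, memℓp_gen hf⟩, rfl, lp.norm_le_of_tsum_le hp0 (by positivity) ?_⟩
    refine (hf.tsum_le_tsum hle (h1.mul_left _)).trans_eq ?_
    rw [tsum_mul_left, h2, Real.mul_rpow hC (norm_nonneg _), lp.norm_rpow_eq_tsum hp0]
  exists_single j :=
    ⟨lp.single p j 1, funext fun n => lp.single_apply p j 1 n, by
      rw [lp.norm_single (zero_lt_one.trans_le Fact.out)]; simp⟩
  injective x y h := lp.ext h

theorem norm_zeroAtInfty_le_iff {𝕜 : Type*} [RCLike 𝕜] {x : C₀(ℤ, 𝕜)} {C : ℝ} (hC : 0 ≤ C) :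
    ‖x‖ ≤ C ↔ ∀ n, ‖x n‖ ≤ C := by
  rw [← ZeroAtInftyContinuousMap.norm_toBCF_eq_norm]
  exact BoundedContinuousFunction.norm_le hC

theorem isSequenceSpace_zeroAtInfty (𝕜 : Type*) [RCLike 𝕜] :
    IsSequenceSpace (𝕜 := 𝕜) (E := C₀(ℤ, 𝕜))
      { toFun := fun x => ⇑x, map_add' := fun _ _ => rfl, map_smul' := fun _ _ => rfl } where
  norm_coord_le x n := (norm_zeroAtInfty_le_iff (norm_nonneg x)).1 le_rfl n
  exists_of_le {C} hC f x k h := by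
    have h1 : Tendsto (fun n : ℤ => x (n + k)) (cocompact ℤ) (𝓝 0) :=
      x.zero_at_infty'.comp (Homeomorph.addRight k).isClosedEmbedding.tendsto_cocompact
    have h2 : Tendsto f (cocompact ℤ) (𝓝 0) :=
      squeeze_zero_norm (a := fun n => C * ‖x (n + k)‖) h (by simpa using h1.norm.const_mul C)
    refine ⟨⟨⟨f, continuous_of_discreteTopology⟩, h2⟩, rfl,
      (norm_zeroAtInfty_le_iff (by positivity)).2 fun n => (h n).trans ?_⟩
    exact mul_le_mul_of_nonneg_left
      ((norm_zeroAtInfty_le_iff (norm_nonneg x)).1 le_rfl (n + k)) hC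
  exists_single j := by
    have h : Tendsto (Pi.single j 1 : ℤ → 𝕜) (cocompact ℤ) (𝓝 0) := by
      refine tendsto_nhds_of_eventually_eq ?_
      rw [cocompact_eq_cofinite]
      filter_upwards [(Set.finite_singleton j).compl_mem_cofinite] with n hn
      exact Pi.single_eq_of_ne hn 1
    refine ⟨⟨⟨Pi.single j 1, continuous_of_discreteTopology⟩, h⟩, rfl,
      (norm_zeroAtInfty_le_iff zero_le_one).2 fun n => ?_⟩
    change ‖(Pi.single j 1 : ℤ → 𝕜) n‖ ≤ 1
    by_cases hn : n = j
    · subst hn; simp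
    · simp [hn]
  injective x y h := DFunLike.coe_injective h

end SequenceSpace

end BilateralShift

theorem theorem1p1 {𝕜 : Type*} [RCLike 𝕜] (w : ℤ → ℝ) (hw : BilateralShift.IsAdmissibleWeight w) :
    (∀ (p : ℝ≥0∞) [Fact (1 ≤ p)] (hp : p ≠ ∞),
      BilateralShift.StronglyStructurallyStable (BilateralShift.shiftLp 𝕜 p hp w hw) ↔
        BilateralShift.ConditionA w ∨ BilateralShift.ConditionB w ∨
          BilateralShift.ConditionC w) ∧
    (BilateralShift.StronglyStructurallyStable (BilateralShift.shiftC0 𝕜 w hw) ↔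
      BilateralShift.ConditionA w ∨ BilateralShift.ConditionB w ∨
        BilateralShift.ConditionC w) :=
  ⟨fun _ _ hp => (BilateralShift.isSequenceSpace_lp 𝕜 hp).stronglyStructurallyStable_iff hw
    fun _ _ => rfl,
  (BilateralShift.isSequenceSpace_zeroAtInfty 𝕜).stronglyStructurallyStable_iff hw
    fun _ _ => rfl⟩
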